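/- Let $\mathcal X,\tilde{\mathcal Y}_{1a},\mathcal Y_{1b},\tilde{\mathcal Y}_{2a},\mathcal Y_{2b}$ be finite alphabets and consider the four-receiver discrete memoryless broadcast channel (without feedback) with transition probability $p(\tilde y_{1a},y_{1b},\tilde y_{2a},y_{2b}\mid x)$. The transmitter has three independent messages $W_0,W_1,W_2$, uniformly distributed on their message sets of sizes $M_0^{(n)},M_1^{(n)},M_2^{(n)}$, and maps them by a stochastic encoder to an input word $X^n$. Message $W_0$ is intended for both receivers $1b$ and $2b$; $W_1$ is intended for receiver $1a$ and must be kept secret from receiver $2b$; $W_2$ is intended for receiver $2a$ and must be kept secret from receiver $1b$. A triple $(R_0,R_1,R_2)$ of nonnegative reals is achievable if there is a sequence of codes of block lengths $n=1,2,\dots$ with $\liminf_n \frac1n\log M_j^{(n)}\ge R_j$ for $j=0,1,2$, such that the probability that some receiver decodes one of its intended messages wrongly tends to $0$, and $$\frac1n I(W_1;Y_{2b}^n)\to 0,\qquad \frac1n I(W_2;Y_{1b}^n)\to 0 .$$ The secrecy capacity region $\mathcal C_s$ is the closure of the set of achievable triples. Suppose that $X\to\tilde Y_{1a}\to(Y_{1b},Y_{2b})$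 and $X\to\tilde Y_{2a}\to(Y_{1b},Y_{2b})$ are Markov chains (for every distribution of the input $X$). Then $\mathcal C_s\subseteq\mathcal R_o$, where $\mathcal R_o$ is the set of nonnegative triples $(R_0,R_1,R_2)$ such that $$R_0\le\min\{I(U;Y_{1b}),\,I(U;Y_{2b})\},$$ $$R_1\le I(X;\tilde Y_{1a}\mid U)-I(X;Y_{2b}\mid U),$$ $$R_2\le I(X;\tilde Y_{2a}\mid U)-I(X;Y_{1b}\mid U)$$ for some random variable $U$ with finitely many values and some joint law $p(u)\,p(x\mid u)\,p(\tilde y_{1a},y_{1b},\tilde y_{2a},y_{2b}\mid x)$. All logarithms, in the rates and in the information quantities, are to the same base. -/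

import Mathlib

namespace BroadcastChannel

noncomputable section

/-! ### Finite-alphabet information measures (natural logarithm)

A random variable is a function on a finite sample space that carries a probability mass
function `p`. -/

/-- `prob p X a = P(X = a)`. -/
def prob {Ω α : Type*} (p : PMF Ω) (X : Ω → α) (a : α) : ℝ :=
  (p.map X a).toReal

/-- Shannon entropy `H(X) = -∑ₐ P(X = a) log P(X = a)`, with `0 log 0 = 0`. -/
def entropy {Ω α : Type*} [Fintype α] (p : PMF Ω) (X : Ω → α) : ℝ :=
  ∑ a, Real.negMulLog (prob p X a)

/-- Conditional entropy `H(X | Z) = H(X, Z) - H(Z)`. -/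
def condEntropy {Ω α γ : Type*} [Fintype α] [Fintype γ]
    (p : PMF Ω) (X : Ω → α) (Z : Ω → γ) : ℝ :=
  entropy p (fun ω => (X ω, Z ω)) - entropy p Z

/-- Mutual information `I(X; Y) = H(X) + H(Y) - H(X, Y)`. -/
def mutualInfo {Ω α β : Type*} [Fintype α] [Fintype β]
    (p : PMF Ω) (X : Ω → α) (Y : Ω → β) : ℝ :=
  entropy p X + entropy p Y - entropy p (fun ω => (X ω, Y ω))

/-- Conditional mutual information `I(X; Y | Z) = H(X | Z) + H(Y | Z) - H(X, Y | Z)`. -/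
def condMutualInfo {Ω α β γ : Type*} [Fintype α] [Fintype β] [Fintype γ]
    (p : PMF Ω) (X : Ω → α) (Y : Ω → β) (Z : Ω → γ) : ℝ :=
  condEntropy p X Z + condEntropy p Y Z - condEntropy p (fun ω => (X ω, Y ω)) Z

/-- `X → Y → Z` is a Markov chain: `X` and `Z` are conditionally independent given `Y`, that is,
`p(x, y, z) p(y) = p(x, y) p(y, z)` for all `x`, `y`, `z`. -/
def IsMarkovChain {Ω α β γ : Type*} (p : PMF Ω) (X : Ω → α) (Y : Ω → β) (Z : Ω → γ) : Prop :=
  ∀ x y z,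
    prob p (fun ω => (X ω, Y ω, Z ω)) (x, y, z) * prob p Y y =
      prob p (fun ω => (X ω, Y ω)) (x, y) * prob p (fun ω => (Y ω, Z ω)) (y, z)

/-! ### Channels -/

/-- The joint law of the input `a`, drawn from `p`, and of the output of the channel `W`
on input `a`. -/
def joint {α β : Type*} (p : PMF α) (W : α → PMF β) : PMF (α × β) :=
  p.bind fun a => (W a).map fun b => (a, b)

/-- The product of finitely many probability mass functions on a finite alphabet. -/
def piPMF {n : ℕ} {β : Type*} [Fintype β] (q : Fin n → PMF β) : PMF (Fin n → β) :=
  PMF.ofFintype (fun y => ∏ i, q i (y i)) (by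
    classical
    rw [← Fintype.piFinset_univ, ← Finset.prod_univ_sum]
    refine Finset.prod_eq_one fun i _ => ?_
    rw [← tsum_fintype (L := .unconditional _)]
    exact (q i).tsum_coe)

/-- `n` uses of the memoryless channel `W` (without feedback):
`Wⁿ(yⁿ | xⁿ) = ∏ᵢ W(yᵢ | xᵢ)`. -/
def memoryless {α β : Type*} [Fintype β] (W : α → PMF β) (n : ℕ) (x : Fin n → α) :
    PMF (Fin n → β) :=
  piPMF fun i => W (x i)

/-! ### Codes

The output of the four-receiver broadcast channel is a quadruple, in the order
`(1a, 1b, 2a, 2b)`. -/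

/-- A code of block length `n`: message sets of sizes `M₀`, `M₁`, `M₂`, a stochastic encoder, and
one decoder for each receiver. Receivers `1b` and `2b` decode the common message `W₀`, receiver
`1a` decodes `W₁`, and receiver `2a` decodes `W₂`. -/
structure Code (X Y1a Y1b Y2a Y2b : Type*) (n : ℕ) where
  M₀ : ℕ
  M₁ : ℕ
  M₂ : ℕ
  neZero₀ : NeZero M₀
  neZero₁ : NeZero M₁
  neZero₂ : NeZero M₂
  enc : Fin M₀ × Fin M₁ × Fin M₂ → PMF (Fin n → X)
  dec1a : (Fin n → Y1a) → Fin M₁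
  dec1b : (Fin n → Y1b) → Fin M₀
  dec2a : (Fin n → Y2a) → Fin M₂
  dec2b : (Fin n → Y2b) → Fin M₀

attribute [instance] Code.neZero₀ Code.neZero₁ Code.neZero₂

namespace Code

variable {X Y1a Y1b Y2a Y2b : Type*} {n : ℕ}

/-- The sample space of a code: message triple, channel input word, channel output word. -/
abbrev Sample (c : Code X Y1a Y1b Y2a Y2b n) : Type _ :=
  ((Fin c.M₀ × Fin c.M₁ × Fin c.M₂) × (Fin n → X)) × (Fin n → Y1a × Y1b × Y2a × Y2b)

variable (c : Code X Y1a Y1b Y2a Y2b n)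

/-- The common message. -/
def W0 (ω : c.Sample) : Fin c.M₀ := ω.1.1.1

/-- The confidential message for receiver `1a`. -/
def W1 (ω : c.Sample) : Fin c.M₁ := ω.1.1.2.1

/-- The confidential message for receiver `2a`. -/
def W2 (ω : c.Sample) : Fin c.M₂ := ω.1.1.2.2

/-- The word received by receiver `1a`. -/
def out1a (ω : c.Sample) : Fin n → Y1a := fun i => (ω.2 i).1

/-- The word received by receiver `1b`. -/
def out1b (ω : c.Sample) : Fin n → Y1b := fun i => (ω.2 i).2.1

/-- The word received by receiver `2a`. -/
def out2a (ω : c.Sample) : Fin n → Y2a := fun i => (ω.2 i).2.2.1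

/-- The word received by receiver `2b`. -/
def out2b (ω : c.Sample) : Fin n → Y2b := fun i => (ω.2 i).2.2.2

variable [Fintype Y1a] [Fintype Y1b] [Fintype Y2a] [Fintype Y2b]
  (W : X → PMF (Y1a × Y1b × Y2a × Y2b))

/-- The law induced by a code: `(W₀, W₁, W₂)` is uniform (so that the three messages are
independent), the input word is drawn by the encoder, and the output word by `n` memoryless uses
of the channel, which depend on the messages through the input word only. -/
def law : PMF c.Sample :=
  joint (joint (PMF.uniformOfFintype _) c.enc) fun a => memoryless W n a.2

/-- The (average) probability that at least one receiver decodes its message wrongly. -/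
def errorProb : ℝ :=
  ((c.law W).toOuterMeasure
    {ω | c.dec1b (c.out1b ω) ≠ c.W0 ω ∨ c.dec2b (c.out2b ω) ≠ c.W0 ω ∨
      c.dec1a (c.out1a ω) ≠ c.W1 ω ∨ c.dec2a (c.out2a ω) ≠ c.W2 ω}).toReal

/-- The normalized leakage `(1/n) I(W₁; Y₂bⁿ)`. -/
def leakage1 : ℝ := mutualInfo (c.law W) c.W1 c.out2b / n

/-- The normalized leakage `(1/n) I(W₂; Y₁bⁿ)`. -/
def leakage2 : ℝ := mutualInfo (c.law W) c.W2 c.out1b / n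

end Code

/-! ### Rate regions -/

section Regions

variable {X Y1a Y1b Y2a Y2b : Type*}
  [Fintype X] [Fintype Y1a] [Fintype Y1b] [Fintype Y2a] [Fintype Y2b]
  (W : X → PMF (Y1a × Y1b × Y2a × Y2b))

/-- A nonnegative rate triple `(R₀, R₁, R₂)` is achievable if there are codes, one for each block
length `n`, whose rates are asymptotically at least `R₀`, `R₁`, `R₂`, whose error probability
tends to `0`, and whose normalized leakages tend to `0`. -/
def IsAchievable (R : ℝ × ℝ × ℝ) : Prop :=
  0 ≤ R.1 ∧ 0 ≤ R.2.1 ∧ 0 ≤ R.2.2 ∧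
  ∃ c : ∀ n : ℕ, Code X Y1a Y1b Y2a Y2b n,
    (∀ δ > 0, ∀ᶠ n : ℕ in Filter.atTop,
      R.1 - δ ≤ Real.log (c n).M₀ / n ∧
      R.2.1 - δ ≤ Real.log (c n).M₁ / n ∧
      R.2.2 - δ ≤ Real.log (c n).M₂ / n) ∧
    Filter.Tendsto (fun n => (c n).errorProb W) Filter.atTop (nhds 0) ∧
    Filter.Tendsto (fun n => (c n).leakage1 W) Filter.atTop (nhds 0) ∧
    Filter.Tendsto (fun n => (c n).leakage2 W) Filter.atTop (nhds 0)

/-- The secrecy capacity region: the closure of the set of achievable rate triples. -/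
def secrecyCapacityRegion : Set (ℝ × ℝ × ℝ) :=
  closure {R | IsAchievable W R}

/-- The law of `((U, X), (Y1a, Y1b, Y2a, Y2b))` for `p(u) p(x | u) W(y | x)`. -/
def auxLaw {k : ℕ} (pU : PMF (Fin k)) (pX : Fin k → PMF X) :
    PMF ((Fin k × X) × (Y1a × Y1b × Y2a × Y2b)) :=
  joint (joint pU pX) fun a => W a.2

/-- The nonnegative rate triples that satisfy the single-letter bounds for some `p(u) p(x | u)`,
where `U` takes finitely many values. -/
def outerRegion : Set (ℝ × ℝ × ℝ) :=
  {R | 0 ≤ R.1 ∧ 0 ≤ R.2.1 ∧ 0 ≤ R.2.2 ∧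
    ∃ (k : ℕ) (pU : PMF (Fin k)) (pX : Fin k → PMF X),
      R.1 ≤ min
        (mutualInfo (auxLaw W pU pX) (fun ω => ω.1.1) (fun ω => ω.2.2.1))
        (mutualInfo (auxLaw W pU pX) (fun ω => ω.1.1) (fun ω => ω.2.2.2.2)) ∧
      R.2.1 ≤
        condMutualInfo (auxLaw W pU pX) (fun ω => ω.1.2) (fun ω => ω.2.1) (fun ω => ω.1.1) -
        condMutualInfo (auxLaw W pU pX) (fun ω => ω.1.2) (fun ω => ω.2.2.2.2)
          (fun ω => ω.1.1) ∧
      R.2.2 ≤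
        condMutualInfo (auxLaw W pU pX) (fun ω => ω.1.2) (fun ω => ω.2.2.2.1)
          (fun ω => ω.1.1) -
        condMutualInfo (auxLaw W pU pX) (fun ω => ω.1.2) (fun ω => ω.2.2.1) (fun ω => ω.1.1)}

end Regions

end

end BroadcastChannel

/-!
The converse uses the auxiliary variable `Uᵢ = (W₀, G₁, …, Gᵢ₋₁)`, where `Gⱼ = (Y1bⱼ, Y2bⱼ)`: the
common message and the past outputs of *both* weak receivers. One and the same `Uᵢ` serves all
bounds.

* Common message: `I(W₀; Y1bⁿ) ≤ ∑ᵢ I(Uᵢ; Y1bᵢ)`, because enlarging `Uᵢ` only helps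
  (`mutualInfo_le_sum`); likewise for `Y2b`. Fano's inequality (`fano`) relates the left side to
  `log M₀`.
* Confidential messages: up to the leakage and two Fano terms, `H(W₁)` is at most
  `I(W₁; Y1aⁿ | Y2bⁿ, W₀)` (`condEntropy_le`). The term `H(W₀ | Y2bⁿ)`, small because receiver `2b`
  decodes `W₀`, replaces the appeal to the independence of the messages. Giving the word `Gⁿ` to
  receiver `1a` allows the chain rule to be applied to `(Y1a, G)`; conditioning reduces entropy, and
  the channel is memoryless, so the bound becomes `∑ᵢ I(Xᵢ; Y1aᵢ, Gᵢ | Y2bᵢ, Uᵢ)`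
  (`condInfo_le_sum`). Degradedness makes `Gᵢ` worthless next to `Y1aᵢ`
  (`outputEntropy_sub_noiseEntropy_of_isMarkovChain`), which leaves
  `∑ᵢ I(Xᵢ; Y1aᵢ | Uᵢ) - I(Xᵢ; Y2bᵢ | Uᵢ)`. The bound for `W₂` is the same with the roles exchanged.

Time sharing and the passage to the limit take place in the set `infoRegion`, the convex hull of the
vectors of information quantities over all input laws: a variable `U` is a convex combination of
conditional input laws, so averaging over `i` is convexity. As the convex hull of a compact set in
finite dimension, `infoRegion` is compact, which also supplies the closedness of the outer region
without a separate bound on the number of values of `U`: the smallest slack in the four bounds is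
continuous, hence attains its maximum, which is nonnegative if it exceeds every negative number
(`mem_outerRegion_of_forall_pos`).
-/

namespace BroadcastChannel

/-! ### Entropy of finite-valued random variables -/

section Entropy

variable {Ω α β γ : Type*}

lemma prob_eq_sum [Fintype Ω] [DecidableEq α] (p : PMF Ω) (X : Ω → α) (a : α) :
    prob p X a = ∑ ω, if X ω = a then (p ω).toReal else 0 := by
  rw [prob, PMF.map_apply, tsum_fintype, ENNReal.toReal_sum]
  · refine Finset.sum_congr rfl fun ω _ => ?_
    by_cases h : X ω = a
    · simp [h]
    · simp [h, Ne.symm h]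
  · intro ω _
    split_ifs
    · exact p.apply_ne_top ω
    · exact ENNReal.zero_ne_top

lemma prob_nonneg (p : PMF Ω) (X : Ω → α) (a : α) : 0 ≤ prob p X a := ENNReal.toReal_nonneg

lemma sum_prob_mul [Fintype Ω] [Fintype α] (p : PMF Ω) (X : Ω → α) (F : α → ℝ) :
    ∑ a, prob p X a * F a = ∑ ω, (p ω).toReal * F (X ω) := by
  classical
  simp_rw [prob_eq_sum, Finset.sum_mul]
  rw [Finset.sum_comm]
  refine Finset.sum_congr rfl fun ω _ => ?_
  simp [ite_mul]

lemma sum_toReal [Fintype Ω] (p : PMF Ω) : ∑ ω, (p ω).toReal = 1 := by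
  rw [← ENNReal.toReal_sum fun ω _ => p.apply_ne_top ω, ← tsum_fintype (L := .unconditional _),
    p.tsum_coe, ENNReal.toReal_one]

lemma sum_prob [Fintype α] (p : PMF Ω) (X : Ω → α) : ∑ a, prob p X a = 1 :=
  sum_toReal (p.map X)

lemma prob_mem_stdSimplex [Fintype α] (p : PMF Ω) (X : Ω → α) : prob p X ∈ stdSimplex ℝ α :=
  ⟨prob_nonneg p X, sum_prob p X⟩

lemma toReal_le_prob [Fintype Ω] (p : PMF Ω) (X : Ω → α) (ω : Ω) :
    (p ω).toReal ≤ prob p X (X ω) := by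
  classical
  rw [prob_eq_sum]
  refine le_trans (by simp) (Finset.single_le_sum
    (f := fun ω' => if X ω' = X ω then (p ω').toReal else 0) (fun ω' _ => ?_) (Finset.mem_univ ω))
  split_ifs
  · exact ENNReal.toReal_nonneg
  · rfl

/-- `P(X = X ω) ≤ P(Y = Y ω)` whenever `X` determines `Y`. -/
lemma prob_le_of_factorsThrough [Fintype Ω] (p : PMF Ω) {X : Ω → α} {Y : Ω → β}
    (h : Y.FactorsThrough X) (ω : Ω) : prob p X (X ω) ≤ prob p Y (Y ω) := by
  classical
  rw [prob_eq_sum, prob_eq_sum]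
  refine Finset.sum_le_sum fun ω' _ => ?_
  by_cases hX : X ω' = X ω
  · rw [if_pos hX, if_pos (h hX)]
  · rw [if_neg hX]
    split_ifs
    · exact ENNReal.toReal_nonneg
    · rfl

lemma sum_prob_fst [Fintype Ω] [Fintype α] (p : PMF Ω) (X : Ω → α) (Y : Ω → β) (b : β) :
    ∑ a, prob p (fun ω => (X ω, Y ω)) (a, b) = prob p Y b := by
  classical
  simp_rw [prob_eq_sum]
  rw [Finset.sum_comm]
  refine Finset.sum_congr rfl fun ω _ => ?_
  simp [Prod.ext_iff, ite_and]

lemma sum_prob_snd [Fintype Ω] [Fintype β] (p : PMF Ω) (X : Ω → α) (Y : Ω → β) (a : α) :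
    ∑ b, prob p (fun ω => (X ω, Y ω)) (a, b) = prob p X a := by
  classical
  simp_rw [prob_eq_sum]
  rw [Finset.sum_comm]
  refine Finset.sum_congr rfl fun ω _ => ?_
  simp [Prod.ext_iff, ite_and]

/-- Entropy as the expectation of the self-information `-log P(X = X ω)`. -/
lemma entropy_eq_sum [Fintype Ω] [Fintype α] (p : PMF Ω) (X : Ω → α) :
    entropy p X = ∑ ω, (p ω).toReal * -Real.log (prob p X (X ω)) := by
  rw [← sum_prob_mul p X fun a => -Real.log (prob p X a)]
  exact Finset.sum_congr rfl fun a _ => by rw [Real.negMulLog]; ring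

/-- `H(Y) ≤ H(X)` when `X` determines `Y`. -/
lemma entropy_le_of_factorsThrough [Fintype Ω] [Fintype α] [Fintype β] (p : PMF Ω) {X : Ω → α}
    {Y : Ω → β} (h : Y.FactorsThrough X) : entropy p Y ≤ entropy p X := by
  rw [entropy_eq_sum, entropy_eq_sum]
  refine Finset.sum_le_sum fun ω _ => ?_
  rcases (ENNReal.toReal_nonneg (a := p ω)).eq_or_lt with h0 | h0
  · simp [← h0]
  · refine mul_le_mul_of_nonneg_left (neg_le_neg ?_) h0.le
    exact Real.log_le_log (h0.trans_le (toReal_le_prob p X ω)) (prob_le_of_factorsThrough p h ω)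

/-- Entropy depends only on the partition that a random variable induces. -/
lemma entropy_congr [Fintype Ω] [Fintype α] [Fintype β] (p : PMF Ω) {X : Ω → α} {Y : Ω → β}
    (h : ∀ ω ω', X ω = X ω' ↔ Y ω = Y ω') : entropy p X = entropy p Y :=
  le_antisymm (entropy_le_of_factorsThrough p fun _ _ e => (h _ _).2 e)
    (entropy_le_of_factorsThrough p fun _ _ e => (h _ _).1 e)

lemma entropy_of_subsingleton [Fintype Ω] [Fintype α] [Subsingleton α] (p : PMF Ω) (X : Ω → α) :
    entropy p X = 0 := by
  classical
  rw [entropy_eq_sum]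
  refine Finset.sum_eq_zero fun ω _ => ?_
  have : prob p X (X ω) = 1 := by
    rw [prob_eq_sum, ← sum_toReal p]
    exact Finset.sum_congr rfl fun ω' _ => if_pos (Subsingleton.elim _ _)
  simp [this]

/-- Gibbs' inequality. -/
lemma entropy_le_sum_neg_log [Fintype α] (p : PMF Ω) (X : Ω → α) (r : α → ℝ) (hr : ∀ a, 0 ≤ r a)
    (hsum : ∑ a, r a ≤ 1) (h0 : ∀ a, r a = 0 → prob p X a = 0) :
    entropy p X ≤ ∑ a, prob p X a * -Real.log (r a) := by
  have key : ∀ a, Real.negMulLog (prob p X a) ≤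
      prob p X a * -Real.log (r a) + (r a - prob p X a) := by
    intro a
    rcases (prob_nonneg p X a).eq_or_lt with hp | hp
    · simp [← hp, hr a]
    · have hra : 0 < r a := (hr a).lt_of_ne fun h => hp.ne' (h0 a h.symm)
      have := Real.log_le_sub_one_of_pos (div_pos hra hp)
      rw [Real.log_div hra.ne' hp.ne'] at this
      have h2 := mul_le_mul_of_nonneg_left this hp.le
      have h3 : prob p X a * (r a / prob p X a - 1) = r a - prob p X a := by field_simp
      rw [Real.negMulLog]
      nlinarith
  calc entropy p X ≤ ∑ a, (prob p X a * -Real.log (r a) + (r a - prob p X a)) :=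
        Finset.sum_le_sum fun a _ => key a
    _ ≤ _ := by
        rw [Finset.sum_add_distrib, Finset.sum_sub_distrib, sum_prob]
        linarith

/-- Submodularity of entropy, `I(X; Y | Z) ≥ 0`. -/
lemma entropy_triple_add_le [Fintype Ω] [Fintype α] [Fintype β] [Fintype γ] (p : PMF Ω)
    (X : Ω → α) (Y : Ω → β) (Z : Ω → γ) :
    entropy p (fun ω => (X ω, Y ω, Z ω)) + entropy p Z ≤
      entropy p (fun ω => (X ω, Z ω)) + entropy p (fun ω => (Y ω, Z ω)) := by
  set PXZ := prob p (fun ω => (X ω, Z ω)) with hXZ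
  set PYZ := prob p (fun ω => (Y ω, Z ω)) with hYZ
  set PZ := prob p Z with hZ
  -- The comparison measure is the one that makes `X` and `Y` conditionally independent given `Z`.
  have hG := entropy_le_sum_neg_log p (fun ω => (X ω, Y ω, Z ω))
    (fun a => PXZ (a.1, a.2.2) * PYZ (a.2.1, a.2.2) / PZ a.2.2)
    (fun a => div_nonneg (mul_nonneg (prob_nonneg _ _ _) (prob_nonneg _ _ _)) (prob_nonneg _ _ _))
    (by
      have : ∀ z, (∑ x, ∑ y, PXZ (x, z) * PYZ (y, z) / PZ z) = PZ z := by
        intro z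
        simp_rw [← Finset.sum_div, ← Finset.mul_sum, ← Finset.sum_mul, hXZ, hYZ, sum_prob_fst, hZ]
        exact mul_self_div_self _
      simp_rw [Fintype.sum_prod_type]
      rw [Finset.sum_congr rfl fun x _ => Finset.sum_comm, Finset.sum_comm,
        Finset.sum_congr rfl fun z _ => this z, hZ, sum_prob])
    (by
      intro a ha
      by_contra hne
      obtain ⟨ω, hω, hp⟩ : ∃ ω, (X ω, Y ω, Z ω) = a ∧ 0 < (p ω).toReal := by
        classical
        rw [prob_eq_sum] at hne
        obtain ⟨ω, -, h⟩ := Finset.exists_ne_zero_of_sum_ne_zero hne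
        by_cases hω : (X ω, Y ω, Z ω) = a
        · exact ⟨ω, hω, lt_of_le_of_ne ENNReal.toReal_nonneg fun h' => h (by simp [← h'])⟩
        · simp [hω] at h
      subst hω
      have h1 := hp.trans_le (toReal_le_prob p (fun ω => (X ω, Z ω)) ω)
      have h2 := hp.trans_le (toReal_le_prob p (fun ω => (Y ω, Z ω)) ω)
      have h3 := hp.trans_le (toReal_le_prob p Z ω)
      exact (div_pos (mul_pos h1 h2) h3).ne' ha)
  rw [sum_prob_mul p (fun ω => (X ω, Y ω, Z ω))
    (fun a => -Real.log (PXZ (a.1, a.2.2) * PYZ (a.2.1, a.2.2) / PZ a.2.2))] at hG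
  refine (add_le_add_left hG _).trans_eq ?_
  rw [entropy_eq_sum p Z, entropy_eq_sum p (fun ω => (X ω, Z ω)),
    entropy_eq_sum p (fun ω => (Y ω, Z ω)), ← Finset.sum_add_distrib, ← Finset.sum_add_distrib]
  refine Finset.sum_congr rfl fun ω _ => ?_
  rcases (ENNReal.toReal_nonneg (a := p ω)).eq_or_lt with h0 | h0
  · simp [← h0]
  · have h1 := h0.trans_le (toReal_le_prob p (fun ω => (X ω, Z ω)) ω)
    have h2 := h0.trans_le (toReal_le_prob p (fun ω => (Y ω, Z ω)) ω)
    have h3 := h0.trans_le (toReal_le_prob p Z ω)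
    rw [Real.log_div (mul_pos h1 h2).ne' h3.ne', Real.log_mul h1.ne' h2.ne']
    ring

/-- Submodularity in terms of partitions: if `S` and `T` both determine `I`, and together determine
`J`, then `H(J) + H(I) ≤ H(S) + H(T)`. -/
lemma entropy_add_le_of_factorsThrough [Fintype Ω] {σ τ ι κ : Type*} [Fintype σ] [Fintype τ]
    [Fintype ι] [Fintype κ] (p : PMF Ω) (J : Ω → κ) (I : Ω → ι) (S : Ω → σ) (T : Ω → τ)
    (hS : I.FactorsThrough S) (hT : I.FactorsThrough T)
    (hJ : J.FactorsThrough fun ω => (S ω, T ω)) :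
    entropy p J + entropy p I ≤ entropy p S + entropy p T := by
  have h := entropy_triple_add_le p S T I
  have e1 : entropy p (fun ω => (S ω, I ω)) = entropy p S := entropy_congr p fun ω ω' =>
    ⟨fun e => (Prod.ext_iff.1 e).1, fun e => Prod.ext e (hS e)⟩
  have e2 : entropy p (fun ω => (T ω, I ω)) = entropy p T := entropy_congr p fun ω ω' =>
    ⟨fun e => (Prod.ext_iff.1 e).1, fun e => Prod.ext e (hT e)⟩
  have e3 : entropy p J ≤ entropy p (fun ω => (S ω, T ω, I ω)) :=
    entropy_le_of_factorsThrough p fun ω ω' e =>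
      hJ (Prod.ext (Prod.ext_iff.1 e).1 (Prod.ext_iff.1 (Prod.ext_iff.1 e).2).1)
  linarith

/-- For a Markov chain `X → Y → Z`, submodularity holds with equality. -/
lemma IsMarkovChain.entropy_add [Fintype Ω] [Fintype α] [Fintype β] [Fintype γ] {p : PMF Ω}
    {X : Ω → α} {Y : Ω → β} {Z : Ω → γ} (h : IsMarkovChain p X Y Z) :
    entropy p (fun ω => (X ω, Y ω, Z ω)) + entropy p Y =
      entropy p (fun ω => (X ω, Y ω)) + entropy p (fun ω => (Y ω, Z ω)) := by
  rw [entropy_eq_sum p Y, entropy_eq_sum p (fun ω => (X ω, Y ω)),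
    entropy_eq_sum p (fun ω => (Y ω, Z ω)), entropy_eq_sum p (fun ω => (X ω, Y ω, Z ω)),
    ← Finset.sum_add_distrib, ← Finset.sum_add_distrib]
  refine Finset.sum_congr rfl fun ω _ => ?_
  rcases (ENNReal.toReal_nonneg (a := p ω)).eq_or_lt with h0 | h0
  · simp [← h0]
  · have h1 := h0.trans_le (toReal_le_prob p (fun ω => (X ω, Y ω)) ω)
    have h2 := h0.trans_le (toReal_le_prob p (fun ω => (Y ω, Z ω)) ω)
    have h3 := h0.trans_le (toReal_le_prob p Y ω)
    have h4 := h0.trans_le (toReal_le_prob p (fun ω => (X ω, Y ω, Z ω)) ω)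
    have := congrArg Real.log (h (X ω) (Y ω) (Z ω))
    rw [Real.log_mul h4.ne' h3.ne', Real.log_mul h1.ne' h2.ne'] at this
    rw [← mul_add, ← mul_add]
    congr 1
    linarith

/-- Entropy of a uniformly distributed random variable. -/
lemma entropy_eq_log_card [Fintype α] (p : PMF Ω) (X : Ω → α)
    (h : ∀ a, prob p X a = (Fintype.card α : ℝ)⁻¹) :
    entropy p X = Real.log (Fintype.card α) := by
  have hc : (Fintype.card α : ℝ) ≠ 0 := by
    intro h0
    have := sum_prob p X
    simp [h, h0] at this
  simp only [entropy, h, Finset.sum_const, Finset.card_univ, nsmul_eq_mul, Real.negMulLog,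
    Real.log_inv]
  field_simp

open Classical in
/-- Fano's inequality, for an estimate `g ∘ Y` of a random variable `X` with values in a finite
alphabet of size `m`: `H(X | Y) ≤ log 2 + P(g(Y) ≠ X) log m`. -/
lemma fano [Fintype Ω] [Fintype α] [Fintype β] (p : PMF Ω) (X : Ω → α) (Y : Ω → β) (g : β → α) :
    entropy p (fun ω => (X ω, Y ω)) - entropy p Y ≤
      Real.log 2 + (∑ ω, if g (Y ω) ≠ X ω then (p ω).toReal else 0) *
        Real.log (Fintype.card α) := by
  rcases isEmpty_or_nonempty α with hα | hα
  · obtain ⟨ω, -⟩ := p.support_nonempty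
    exact (hα.false (X ω)).elim
  set m : ℝ := (Fintype.card α : ℝ) with hm
  have hm0 : 0 < m := by rw [hm]; exact_mod_cast Fintype.card_pos
  set PY := prob p Y with hPY
  -- Compare with the law under which `X`, given `Y`, is an even mixture of `g(Y)` and a
  -- uniform symbol (the latter is only counted off `g(Y)`).
  set Q : α → β → ℝ := fun x y => if g y ≠ x then (2 * m)⁻¹ else 2⁻¹ with hQ
  have hQpos : ∀ x y, 0 < Q x y := by
    intro x y
    simp only [hQ]
    split_ifs <;> positivity
  have hQsum : ∀ y, ∑ x, Q x y ≤ 1 := by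
    intro y
    calc ∑ x, Q x y ≤ ∑ x, ((2 * m)⁻¹ + if g y = x then 2⁻¹ else 0) := by
          refine Finset.sum_le_sum fun x _ => ?_
          simp only [hQ]
          by_cases hx : g y = x
          · simp only [hx, ne_eq, not_true_eq_false, if_false, if_true]
            linarith [inv_pos.2 (mul_pos two_pos hm0)]
          · simp [hx]
      _ = 1 := by
          rw [Finset.sum_add_distrib]
          simp only [Finset.sum_const, Finset.card_univ, nsmul_eq_mul, ← hm, Finset.sum_ite_eq,
            Finset.mem_univ, if_true]
          field_simp
          norm_num
  have hG := entropy_le_sum_neg_log p (fun ω => (X ω, Y ω)) (fun a => PY a.2 * Q a.1 a.2)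
    (fun a => mul_nonneg (prob_nonneg _ _ _) (hQpos _ _).le)
    (by
      rw [Fintype.sum_prod_type_right]
      simp_rw [← Finset.mul_sum]
      calc ∑ y, PY y * ∑ x, Q x y ≤ ∑ y, PY y * 1 :=
            Finset.sum_le_sum fun y _ => mul_le_mul_of_nonneg_left (hQsum y) (prob_nonneg _ _ _)
        _ = 1 := by simp [hPY, sum_prob])
    (by
      rintro ⟨x, y⟩ h
      have hy : PY y = 0 := (mul_eq_zero.1 h).resolve_right (hQpos x y).ne'
      have hle : prob p (fun ω => (X ω, Y ω)) (x, y) ≤ PY y := by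
        rw [hPY, ← sum_prob_fst p X Y y]
        exact Finset.single_le_sum (f := fun x => prob p (fun ω => (X ω, Y ω)) (x, y))
          (fun _ _ => prob_nonneg _ _ _) (Finset.mem_univ x)
      exact le_antisymm (hle.trans_eq hy) (prob_nonneg _ _ _))
  rw [sum_prob_mul p (fun ω => (X ω, Y ω)) (fun a => -Real.log (PY a.2 * Q a.1 a.2))] at hG
  rw [sub_le_iff_le_add]
  refine hG.trans_eq ?_
  rw [entropy_eq_sum p Y, ← one_mul (Real.log 2), ← sum_toReal p, Finset.sum_mul, Finset.sum_mul,
    ← Finset.sum_add_distrib, ← Finset.sum_add_distrib]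
  refine Finset.sum_congr rfl fun ω _ => ?_
  rcases (ENNReal.toReal_nonneg (a := p ω)).eq_or_lt with h0 | h0
  · simp [← h0]
  · have h1 := h0.trans_le (toReal_le_prob p Y ω)
    rw [Real.log_mul h1.ne' (hQpos _ _).ne']
    simp only [hQ]
    split_ifs
    · rw [Real.log_inv, Real.log_mul two_ne_zero hm0.ne']
      ring
    · rw [Real.log_inv]
      ring

end Entropy

/-! ### Single-letter channel outputs -/

section SingleLetter

variable {Ω α ξ ζ Y : Type*}

/-- The entropy of `f(Y)` when the input of the channel `W` has law `q`. -/
noncomputable def outputEntropy [Fintype ξ] [Fintype ζ] (W : ξ → PMF Y) (f : Y → ζ) (q : ξ → ℝ) :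
    ℝ :=
  ∑ z, Real.negMulLog (∑ x, q x * prob (W x) f z)

/-- The conditional entropy of `f(Y)` given the input `X` of the channel `W`, when `X` has law
`q`. -/
noncomputable def noiseEntropy [Fintype ξ] [Fintype ζ] (W : ξ → PMF Y) (f : Y → ζ) (q : ξ → ℝ) :
    ℝ :=
  ∑ x, q x * entropy (W x) f

/-- Given the input `X`, the variable `Z` is distributed as `f` of an output of the channel `W`,
independently of `U`. -/
def IsOutput (p : PMF Ω) (U : Ω → α) (X : Ω → ξ) (W : ξ → PMF Y) (f : Y → ζ) (Z : Ω → ζ) : Prop :=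
  ∀ u x z, prob p (fun ω => (U ω, X ω, Z ω)) (u, x, z) =
    prob p (fun ω => (U ω, X ω)) (u, x) * prob (W x) f z

lemma sum_prob_middle [Fintype Ω] [Fintype ξ] (p : PMF Ω) (U : Ω → α) (X : Ω → ξ) (Z : Ω → ζ)
    (u : α) (z : ζ) :
    ∑ x, prob p (fun ω => (U ω, X ω, Z ω)) (u, x, z) = prob p (fun ω => (U ω, Z ω)) (u, z) := by
  classical
  simp_rw [prob_eq_sum]
  rw [Finset.sum_comm]
  refine Finset.sum_congr rfl fun ω _ => ?_
  by_cases h1 : U ω = u <;> by_cases h2 : Z ω = z <;> simp [h1, h2]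

/-- Conditional laws exist; where `P(U = u) = 0` the unconditional law is used. -/
lemma exists_condLaw [Fintype Ω] [Fintype ξ] (p : PMF Ω) (U : Ω → α) (X : Ω → ξ) :
    ∃ q : α → ξ → ℝ, (∀ u, q u ∈ stdSimplex ℝ ξ) ∧
      ∀ u x, prob p (fun ω => (U ω, X ω)) (u, x) = prob p U u * q u x := by
  classical
  refine ⟨fun u => if prob p U u = 0 then prob p X else
    fun x => prob p (fun ω => (U ω, X ω)) (u, x) / prob p U u, fun u => ?_, fun u x => ?_⟩
  · by_cases h : prob p U u = 0
    · simp only [h, if_true]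
      exact prob_mem_stdSimplex p X
    · simp only [h, if_false]
      refine ⟨fun x => div_nonneg (prob_nonneg _ _ _) (prob_nonneg _ _ _), ?_⟩
      rw [← Finset.sum_div, sum_prob_snd, div_self h]
  · by_cases h : prob p U u = 0
    · rw [h, zero_mul]
      refine le_antisymm ?_ (prob_nonneg _ _ _)
      rw [← h, ← sum_prob_snd p U X u]
      exact Finset.single_le_sum (f := fun x => prob p (fun ω => (U ω, X ω)) (u, x))
        (fun _ _ => prob_nonneg _ _ _) (Finset.mem_univ x)
    · simp only [h, if_false]
      field_simp

lemma exists_pmf_of_mem_stdSimplex [Fintype ξ] {q : ξ → ℝ} (hq : q ∈ stdSimplex ℝ ξ) :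
    ∃ r : PMF ξ, ∀ x, (r x).toReal = q x := by
  refine ⟨PMF.ofFintype (fun x => ENNReal.ofReal (q x)) ?_, fun x => ?_⟩
  · rw [← ENNReal.ofReal_sum_of_nonneg fun x _ => hq.1 x, hq.2, ENNReal.ofReal_one]
  · rw [PMF.ofFintype_apply, ENNReal.toReal_ofReal (hq.1 x)]

variable [Fintype Ω] [Fintype α] [Fintype ξ] [Fintype ζ] {p : PMF Ω} {U : Ω → α} {X : Ω → ξ}
  {W : ξ → PMF Y} {f : Y → ζ} {Z : Ω → ζ}

/-- `H(U, X, Z) = H(U, X) + H(Z | X)` when `Z` is a channel output. -/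
lemma IsOutput.entropy_triple (h : IsOutput p U X W f Z) :
    entropy p (fun ω => (U ω, X ω, Z ω)) =
      entropy p (fun ω => (U ω, X ω)) + noiseEntropy W f (prob p X) := by
  have e : ∀ x, prob p X x = ∑ u, prob p (fun ω => (U ω, X ω)) (u, x) := fun x =>
    (sum_prob_fst p U X x).symm
  simp only [noiseEntropy, e, Finset.sum_mul]
  rw [Finset.sum_comm, entropy, entropy, Fintype.sum_prod_type, Fintype.sum_prod_type,
    ← Finset.sum_add_distrib]
  refine Finset.sum_congr rfl fun u _ => ?_
  rw [Fintype.sum_prod_type, ← Finset.sum_add_distrib]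
  refine Finset.sum_congr rfl fun x _ => ?_
  simp only [h u x, Real.negMulLog_mul, Finset.sum_add_distrib, ← Finset.mul_sum, ← Finset.sum_mul,
    sum_prob, one_mul, entropy]

/-- `H(U, Z) = H(U) + ∑ᵤ P(u) H(Z | U = u)` when `Z` is a channel output and `q u` is the
conditional law of the input given `U = u`. -/
lemma IsOutput.entropy_pair (h : IsOutput p U X W f Z) (q : α → ξ → ℝ)
    (hq : ∀ u, q u ∈ stdSimplex ℝ ξ)
    (hU : ∀ u x, prob p (fun ω => (U ω, X ω)) (u, x) = prob p U u * q u x) :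
    entropy p (fun ω => (U ω, Z ω)) =
      entropy p U + ∑ u, prob p U u * outputEntropy W f (q u) := by
  have e : ∀ u z, prob p (fun ω => (U ω, Z ω)) (u, z) =
      prob p U u * ∑ x, q u x * prob (W x) f z := by
    intro u z
    rw [← sum_prob_middle p U X Z, Finset.mul_sum]
    exact Finset.sum_congr rfl fun x _ => by rw [h, hU, mul_assoc]
  have h1 : ∀ u, ∑ z, ∑ x, q u x * prob (W x) f z = 1 := by
    intro u
    rw [Finset.sum_comm]
    simp only [← Finset.mul_sum, sum_prob, mul_one]
    exact (hq u).2
  rw [entropy, entropy, Fintype.sum_prod_type, ← Finset.sum_add_distrib]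
  refine Finset.sum_congr rfl fun u _ => ?_
  simp only [e, Real.negMulLog_mul, Finset.sum_add_distrib, ← Finset.mul_sum, ← Finset.sum_mul,
    h1, one_mul, outputEntropy]

lemma IsOutput.entropy_single (h : IsOutput p U X W f Z) :
    entropy p Z = outputEntropy W f (prob p X) := by
  have e : ∀ z, prob p Z z = ∑ x, prob p X x * prob (W x) f z := by
    intro z
    rw [← sum_prob_fst p U Z z]
    simp_rw [← sum_prob_middle p U X Z, h _ _ z]
    rw [Finset.sum_comm]
    exact Finset.sum_congr rfl fun x _ => by rw [← Finset.sum_mul, sum_prob_fst]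
  simp only [entropy, e, outputEntropy]

end SingleLetter

/-! ### Joint laws and memoryless channels -/

section Joint

variable {A B α ξ ζ : Type*}

lemma joint_apply (p : PMF A) (W : A → PMF B) (a : A) (b : B) :
    joint p W (a, b) = p a * W a b := by
  classical
  rw [joint, PMF.bind_apply, tsum_eq_single a]
  · rw [PMF.map_apply, tsum_eq_single b]
    · simp
    · intro b' hb
      simp [Ne.symm hb]
  · intro a' ha
    rw [PMF.map_apply]
    simp [Ne.symm ha]

lemma sum_joint_mul [Fintype A] [Fintype B] (p : PMF A) (W : A → PMF B) (F : A × B → ℝ) :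
    ∑ ω, (joint p W ω).toReal * F ω =
      ∑ a, (p a).toReal * ∑ b, (W a b).toReal * F (a, b) := by
  rw [Fintype.sum_prod_type]
  refine Finset.sum_congr rfl fun a _ => ?_
  rw [Finset.mul_sum]
  refine Finset.sum_congr rfl fun b _ => ?_
  rw [joint_apply, ENNReal.toReal_mul, mul_assoc]

lemma prob_eq_sum_mul {Ω : Type*} [Fintype Ω] [DecidableEq α] (p : PMF Ω) (X : Ω → α) (a : α) :
    prob p X a = ∑ ω, (p ω).toReal * if X ω = a then 1 else 0 := by
  rw [prob_eq_sum]
  exact Finset.sum_congr rfl fun ω _ => by simp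

lemma prob_joint_fst [Fintype A] [Fintype B] (p : PMF A) (W : A → PMF B) (X : A → α) (a : α) :
    prob (joint p W) (fun ω => X ω.1) a = prob p X a := by
  classical
  rw [prob_eq_sum_mul, prob_eq_sum_mul, sum_joint_mul]
  refine Finset.sum_congr rfl fun ω _ => ?_
  change (p ω).toReal * ∑ b, (W ω b).toReal * (if X ω = a then 1 else 0) = _
  rw [← Finset.sum_mul, sum_toReal, one_mul]

lemma isOutput_joint [Fintype A] [Fintype B] (p : PMF A) (W : ξ → PMF B) (X : A → ξ) (U : A → α)
    (f : B → ζ) :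
    IsOutput (joint p fun a => W (X a)) (fun ω => U ω.1) (fun ω => X ω.1) W f
      (fun ω => f ω.2) := by
  classical
  intro u x z
  rw [prob_joint_fst p (fun a => W (X a)) (fun a => (U a, X a)), prob_eq_sum_mul, prob_eq_sum_mul,
    sum_joint_mul, Finset.sum_mul]
  refine Finset.sum_congr rfl fun a _ => ?_
  rw [mul_assoc]
  congr 1
  by_cases h : (U a, X a) = (u, x)
  · have hx : X a = x := (Prod.ext_iff.1 h).2
    have hu : U a = u := (Prod.ext_iff.1 h).1
    simp only [hx, hu, if_true, one_mul, prob_eq_sum_mul, Prod.mk.injEq, true_and]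
  · rw [if_neg h, zero_mul]
    refine Finset.sum_eq_zero fun b _ => ?_
    rw [if_neg, mul_zero]
    intro h'
    simp only [Prod.mk.injEq] at h' h
    exact h ⟨h'.1, h'.2.1⟩

end Joint

section Memoryless

variable {M X Y α ζ : Type*} {n : ℕ} [Fintype Y]

lemma memoryless_toReal (W : X → PMF Y) (x : Fin n → X) (y : Fin n → Y) :
    (memoryless W n x y).toReal = ∏ i, (W (x i) (y i)).toReal := by
  rw [memoryless, piPMF, PMF.ofFintype_apply, ENNReal.toReal_prod]

/-- Under a product law, redrawing one coordinate does not change expectations. -/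
lemma sum_prod_mul_update (w : Fin n → Y → ℝ) (i : Fin n) (hw : ∑ z, w i z = 1)
    (F : (Fin n → Y) → ℝ) :
    ∑ y, (∏ j, w j (y j)) * F y =
      ∑ y, (∏ j, w j (y j)) * ∑ z, w i z * F (Function.update y i z) := by
  classical
  have split : ∀ G : (Fin n → Y) → ℝ, ∑ y, (∏ j, w j (y j)) * G y =
      ∑ v : {j // j ≠ i} → Y, (∏ j, w j.1 (v j)) *
        ∑ z, w i z * G ((Equiv.funSplitAt i Y).symm (z, v)) := by
    intro G
    rw [← (Equiv.funSplitAt i Y).symm.sum_comp, Fintype.sum_prod_type, Finset.sum_comm]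
    refine Finset.sum_congr rfl fun v _ => ?_
    rw [Finset.mul_sum]
    refine Finset.sum_congr rfl fun z _ => ?_
    rw [← Finset.mul_prod_erase _ _ (Finset.mem_univ i)]
    have h1 : ∏ j ∈ Finset.univ.erase i, w j ((Equiv.funSplitAt i Y).symm (z, v) j) =
        ∏ j : {j // j ≠ i}, w j.1 (v j) := by
      rw [Finset.prod_subtype (p := fun j => j ≠ i) (Finset.univ.erase i) (by simp)]
      refine Finset.prod_congr rfl fun j _ => ?_
      simp [j.2]
    rw [h1]
    simp only [Equiv.funSplitAt_symm_apply, dite_true]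
    ring
  rw [split, split]
  refine Finset.sum_congr rfl fun v _ => ?_
  congr 1
  have h2 : ∀ z z', Function.update ((Equiv.funSplitAt i Y).symm (z', v)) i z =
      (Equiv.funSplitAt i Y).symm (z, v) := by
    intro z z'
    ext j
    by_cases hj : j = i
    · subst hj
      simp
    · simp [hj]
  simp only [h2, ← Finset.sum_mul, hw, one_mul]

/-- In `n` uses of a memoryless channel, the `i`-th output depends on everything but itself through
the `i`-th input only. -/
lemma isOutput_memoryless [Fintype M] [Fintype X] (p : PMF (M × (Fin n → X))) (W : X → PMF Y)
    (i : Fin n) (U : (M × (Fin n → X)) × (Fin n → Y) → α)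
    (hU : ∀ a y z, U (a, Function.update y i z) = U (a, y)) (f : Y → ζ) :
    IsOutput (joint p fun a => memoryless W n a.2) U (fun ω => ω.1.2 i) W f
      (fun ω => f (ω.2 i)) := by
  classical
  intro u x z
  rw [prob_eq_sum_mul, prob_eq_sum_mul, sum_joint_mul, sum_joint_mul, Finset.sum_mul]
  refine Finset.sum_congr rfl fun a _ => ?_
  rw [mul_assoc]
  congr 1
  simp only [memoryless_toReal]
  rw [sum_prod_mul_update (fun j y => (W (a.2 j) y).toReal) i (sum_toReal _), Finset.sum_mul]
  refine Finset.sum_congr rfl fun y _ => ?_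
  rw [mul_assoc]
  congr 1
  simp only [hU, Function.update_self, Prod.mk.injEq]
  by_cases hu : U (a, y) = u
  · by_cases hx : a.2 i = x
    · simp only [hu, hx, true_and, and_self, if_true, one_mul, prob_eq_sum_mul]
    · simp [hx]
  · simp [hu]

end Memoryless

/-! ### Convex hulls of compact sets -/

section ConvexHull

/-- In finite dimension the convex hull of a compact set is compact: by Carathéodory's theorem it is
a continuous image of the product of a simplex and finitely many copies of the set. -/
lemma isCompact_convexHull_of_finiteDimensional {E : Type*} [NormedAddCommGroup E]
    [NormedSpace ℝ E] [FiniteDimensional ℝ E] {s : Set E} (hs : IsCompact s) :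
    IsCompact (convexHull ℝ s) := by
  rcases s.eq_empty_or_nonempty with rfl | ⟨x₀, hx₀⟩
  · simp
  set N := Module.finrank ℝ E + 1 with hN
  have himage : convexHull ℝ s = (fun a : (Fin N → ℝ) × (Fin N → E) => ∑ i, a.1 i • a.2 i) ''
      (stdSimplex ℝ (Fin N) ×ˢ Set.univ.pi fun _ => s) := by
    apply Set.Subset.antisymm
    · intro x hx
      obtain ⟨ι, _, z, w, hz, hind, hw, hw1, rfl⟩ := eq_pos_convex_span_of_mem_convexHull hx
      have hcard : Fintype.card ι ≤ Fintype.card (Fin N) := by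
        rw [Fintype.card_fin]
        exact hind.card_le_finrank_succ.trans (Nat.succ_le_succ (Submodule.finrank_le _))
      obtain ⟨e⟩ := Function.Embedding.nonempty_of_card_le hcard
      have hsum : ∑ j, Function.extend e w 0 j = 1 := by
        rw [← hw1]
        refine (Fintype.sum_of_injective e e.injective _ _ (fun j hj => ?_) fun i => ?_).symm
        · rw [Function.extend_apply' _ _ _ fun ⟨i, hi⟩ => hj ⟨i, hi⟩]
          rfl
        · rw [e.injective.extend_apply]
      refine ⟨(Function.extend e w 0, Function.extend e z fun _ => x₀), ⟨⟨fun j => ?_, hsum⟩,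
        fun j _ => ?_⟩, ?_⟩
      · by_cases hj : ∃ i, e i = j
        · obtain ⟨i, rfl⟩ := hj
          simpa only [e.injective.extend_apply] using (hw i).le
        · simp only [Function.extend_apply' _ _ _ hj, Pi.zero_apply, le_refl]
      · by_cases hj : ∃ i, e i = j
        · obtain ⟨i, rfl⟩ := hj
          simpa only [e.injective.extend_apply] using hz ⟨i, rfl⟩
        · simpa only [Function.extend_apply' _ _ _ hj] using hx₀
      · refine (Fintype.sum_of_injective e e.injective _ _ (fun j hj => ?_) fun i => ?_).symm
        · simp only [Function.extend_apply' _ _ _ fun ⟨i, hi⟩ => hj ⟨i, hi⟩, Pi.zero_apply,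
            zero_smul]
        · simp only [e.injective.extend_apply]
    · rintro _ ⟨⟨w, z⟩, ⟨hw, hz⟩, rfl⟩
      exact mem_convexHull_of_exists_fintype w z hw.1 hw.2 (fun i => hz i (Set.mem_univ i)) rfl
  rw [himage]
  refine ((isCompact_stdSimplex ℝ (Fin N)).prod (isCompact_univ_pi fun _ => hs)).image ?_
  fun_prop

end ConvexHull

/-! ### Entropies as functions of the input law -/

section InformationFunctions

variable {X Y ζ η : Type*} [Fintype X] [Fintype ζ] [Fintype η]

lemma continuous_outputEntropy (W : X → PMF Y) (f : Y → ζ) : Continuous (outputEntropy W f) := by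
  unfold outputEntropy
  fun_prop

lemma continuous_noiseEntropy (W : X → PMF Y) (f : Y → ζ) : Continuous (noiseEntropy W f) := by
  unfold noiseEntropy
  fun_prop

lemma noiseEntropy_sum_smul {ι : Type*} [Fintype ι] (W : X → PMF Y) (f : Y → ζ) (w : ι → ℝ)
    (q : ι → X → ℝ) :
    noiseEntropy W f (∑ i, w i • q i) = ∑ i, w i * noiseEntropy W f (q i) := by
  simp only [noiseEntropy, Finset.sum_apply, Pi.smul_apply, smul_eq_mul, Finset.sum_mul,
    Finset.mul_sum, mul_assoc]
  rw [Finset.sum_comm]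

lemma concaveOn_outputEntropy (W : X → PMF Y) (f : Y → ζ) :
    ConcaveOn ℝ (stdSimplex ℝ X) (outputEntropy W f) := by
  refine ⟨convex_stdSimplex ℝ X, fun q hq r hr a b ha hb hab => ?_⟩
  have hpos : ∀ q ∈ stdSimplex ℝ X, ∀ z, 0 ≤ ∑ x, q x * prob (W x) f z := fun q hq z =>
    Finset.sum_nonneg fun x _ => mul_nonneg (hq.1 x) (prob_nonneg _ _ _)
  simp only [outputEntropy, smul_eq_mul]
  rw [Finset.mul_sum, Finset.mul_sum, ← Finset.sum_add_distrib]
  refine Finset.sum_le_sum fun z _ => ?_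
  refine (Real.concaveOn_negMulLog.2 (hpos q hq z) (hpos r hr z) ha hb hab).trans_eq ?_
  congr 1
  simp only [smul_eq_mul, Pi.add_apply, Pi.smul_apply, add_mul, Finset.sum_add_distrib,
    Finset.mul_sum, mul_assoc]

lemma prob_joint_id [Fintype Y] {r : PMF X} {q : X → ℝ} (hr : ∀ x, (r x).toReal = q x)
    (W : X → PMF Y) : prob (joint r W) (fun ω => ω.1) = q := by
  classical
  funext x
  rw [prob_joint_fst r W (fun x => x), prob_eq_sum]
  simp [hr]

/-- If `X → f(Y) → g(Y)` is a Markov chain for every input law, then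
`I(X; f(Y), g(Y)) = I(X; f(Y))`. -/
lemma outputEntropy_sub_noiseEntropy_of_isMarkovChain [Fintype Y] (W : X → PMF Y) (f : Y → ζ)
    (g : Y → η)
    (h : ∀ p : PMF X, IsMarkovChain (joint p W) (fun ω => ω.1) (fun ω => f ω.2) fun ω => g ω.2)
    {q : X → ℝ} (hq : q ∈ stdSimplex ℝ X) :
    outputEntropy W (fun y => (f y, g y)) q - noiseEntropy W (fun y => (f y, g y)) q =
      outputEntropy W f q - noiseEntropy W f q := by
  obtain ⟨r, hr⟩ := exists_pmf_of_mem_stdSimplex hq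
  have e := prob_joint_id hr W
  have h1 := isOutput_joint r W (fun x => x) (fun _ => ()) fun y => (f y, g y)
  have h2 := isOutput_joint r W (fun x => x) (fun _ => ()) f
  have a1 := h1.entropy_triple
  have a2 := h2.entropy_triple
  have b1 := h1.entropy_single
  have b2 := h2.entropy_single
  rw [e] at a1 a2 b1 b2
  have c1 := entropy_congr (joint r W) (X := fun ω => ((), ω.1, f ω.2, g ω.2))
    (Y := fun ω => (ω.1, f ω.2, g ω.2)) (by simp)
  have c2 := entropy_congr (joint r W) (X := fun ω => ((), ω.1, f ω.2))
    (Y := fun ω => (ω.1, f ω.2)) (by simp)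
  have m := (h r).entropy_add
  linarith

end InformationFunctions

/-! ### The outer region as a projection of a compact convex set -/

section Region

lemma prob_eq_sum_smul {Ω α X : Type*} [Fintype Ω] [Fintype α] {p : PMF Ω} {U : Ω → α} {V : Ω → X}
    {q : α → X → ℝ}
    (hU : ∀ u x, prob p (fun ω => (U ω, V ω)) (u, x) = prob p U u * q u x) :
    prob p V = ∑ u, prob p U u • q u := by
  funext x
  rw [← sum_prob_fst p U V x]
  simp [hU]

variable {X Y1a Y1b Y2a Y2b : Type*}
  [Fintype X] [Fintype Y1a] [Fintype Y1b] [Fintype Y2a] [Fintype Y2b]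
  (W : X → PMF (Y1a × Y1b × Y2a × Y2b))

/-- The input law `q` together with `H(Y1b)`, `H(Y2b)`, `I(X; Y1a) - I(X; Y2b)` and
`I(X; Y2a) - I(X; Y1b)` under this law. -/
noncomputable def infoVector (q : X → ℝ) : (X → ℝ) × ℝ × ℝ × ℝ × ℝ :=
  (q, outputEntropy W (fun y => y.2.1) q, outputEntropy W (fun y => y.2.2.2) q,
    (outputEntropy W (fun y => y.1) q - noiseEntropy W (fun y => y.1) q) -
      (outputEntropy W (fun y => y.2.2.2) q - noiseEntropy W (fun y => y.2.2.2) q),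
    (outputEntropy W (fun y => y.2.2.1) q - noiseEntropy W (fun y => y.2.2.1) q) -
      (outputEntropy W (fun y => y.2.1) q - noiseEntropy W (fun y => y.2.1) q))

/-- The law of `X` together with `H(Y1b | U)`, `H(Y2b | U)`, `I(X; Y1a | U) - I(X; Y2b | U)` and
`I(X; Y2a | U) - I(X; Y1b | U)`, for all laws of `(U, X)`. -/
noncomputable def infoRegion : Set ((X → ℝ) × ℝ × ℝ × ℝ × ℝ) :=
  convexHull ℝ (infoVector W '' stdSimplex ℝ X)

lemma isCompact_infoRegion : IsCompact (infoRegion W) := by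
  refine isCompact_convexHull_of_finiteDimensional ((isCompact_stdSimplex ℝ X).image ?_)
  have h1a := (continuous_outputEntropy W fun y => y.1).sub (continuous_noiseEntropy W fun y => y.1)
  have h1b := (continuous_outputEntropy W fun y => y.2.1).sub
    (continuous_noiseEntropy W fun y => y.2.1)
  have h2a := (continuous_outputEntropy W fun y => y.2.2.1).sub
    (continuous_noiseEntropy W fun y => y.2.2.1)
  have h2b := (continuous_outputEntropy W fun y => y.2.2.2).sub
    (continuous_noiseEntropy W fun y => y.2.2.2)
  exact continuous_id.prodMk ((continuous_outputEntropy W fun y => y.2.1).prodMk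
    ((continuous_outputEntropy W fun y => y.2.2.2).prodMk ((h1a.sub h2b).prodMk (h2a.sub h1b))))

lemma mutualInfo_eq_of_isOutput {Ω α Y ζ : Type*} [Fintype Ω] [Fintype α] [Fintype ζ]
    {p : PMF Ω} {U : Ω → α} {V : Ω → X} {W : X → PMF Y} {f : Y → ζ} {Z : Ω → ζ}
    (h : IsOutput p U V W f Z) {q : α → X → ℝ} (hq : ∀ u, q u ∈ stdSimplex ℝ X)
    (hU : ∀ u x, prob p (fun ω => (U ω, V ω)) (u, x) = prob p U u * q u x) :
    mutualInfo p U Z =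
      outputEntropy W f (prob p V) - ∑ u, prob p U u * outputEntropy W f (q u) := by
  rw [mutualInfo, h.entropy_pair q hq hU, h.entropy_single]
  ring

lemma condMutualInfo_eq_of_isOutput {Ω α Y ζ : Type*} [Fintype Ω] [Fintype α] [Fintype ζ]
    {p : PMF Ω} {U : Ω → α} {V : Ω → X} {W : X → PMF Y} {f : Y → ζ} {Z : Ω → ζ}
    (h : IsOutput p U V W f Z) {q : α → X → ℝ} (hq : ∀ u, q u ∈ stdSimplex ℝ X)
    (hU : ∀ u x, prob p (fun ω => (U ω, V ω)) (u, x) = prob p U u * q u x) :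
    condMutualInfo p V Z U =
      ∑ u, prob p U u * (outputEntropy W f (q u) - noiseEntropy W f (q u)) := by
  have h1 := h.entropy_triple
  have h2 := h.entropy_pair q hq hU
  rw [prob_eq_sum_smul hU, noiseEntropy_sum_smul] at h1
  have c1 := entropy_congr p (X := fun ω => ((V ω, Z ω), U ω)) (Y := fun ω => (U ω, V ω, Z ω))
    (by intro ω ω'; simp only [Prod.mk.injEq]; tauto)
  have c2 := entropy_congr p (X := fun ω => (V ω, U ω)) (Y := fun ω => (U ω, V ω))
    (by intro ω ω'; simp only [Prod.mk.injEq]; tauto)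
  have c3 := entropy_congr p (X := fun ω => (Z ω, U ω)) (Y := fun ω => (U ω, Z ω))
    (by intro ω ω'; simp only [Prod.mk.injEq]; tauto)
  simp only [condMutualInfo, condEntropy, mul_sub, Finset.sum_sub_distrib]
  linarith

/-- The points of `infoRegion` are realized by auxiliary variables with finitely many values. -/
lemma mem_outerRegion_of_mem_infoRegion {R : ℝ × ℝ × ℝ} (h0 : 0 ≤ R.1) (h1 : 0 ≤ R.2.1)
    (h2 : 0 ≤ R.2.2) {t : (X → ℝ) × ℝ × ℝ × ℝ × ℝ} (ht : t ∈ infoRegion W)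
    (hb : R.1 ≤ outputEntropy W (fun y => y.2.1) t.1 - t.2.1)
    (hd : R.1 ≤ outputEntropy W (fun y => y.2.2.2) t.1 - t.2.2.1)
    (ha : R.2.1 ≤ t.2.2.2.1) (hc : R.2.2 ≤ t.2.2.2.2) : R ∈ outerRegion W := by
  obtain ⟨ι, _, w, z, hw0, hw1, hz, rfl⟩ := mem_convexHull_iff_exists_fintype.1 ht
  choose q hq hqz using hz
  let e := Fintype.equivFin ι
  obtain ⟨pU, hpU⟩ := exists_pmf_of_mem_stdSimplex (q := fun u => w (e.symm u))
    ⟨fun u => hw0 _, by rw [e.symm.sum_comp, hw1]⟩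
  choose pX hpX using fun u => exists_pmf_of_mem_stdSimplex (hq (e.symm u))
  -- The joint law of `(U, X)` and its marginal.
  have hUX : ∀ u x, prob (auxLaw W pU pX) (fun ω => (ω.1.1, ω.1.2)) (u, x) =
      w (e.symm u) * q (e.symm u) x := by
    intro u x
    classical
    rw [auxLaw, prob_joint_fst (joint pU pX) (fun a => W a.2) (fun a => (a.1, a.2)), prob_eq_sum,
      Finset.sum_eq_single (u, x)]
    · simp [joint_apply, hpU, hpX]
    · rintro ⟨u', x'⟩ - hne
      exact if_neg hne
    · simp
  have hU : ∀ u, prob (auxLaw W pU pX) (fun ω => ω.1.1) u = w (e.symm u) := by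
    intro u
    rw [← sum_prob_snd _ _ (fun ω => ω.1.2)]
    simp only [hUX, ← Finset.mul_sum]
    rw [(hq _).2, mul_one]
  have hUX' : ∀ u x, prob (auxLaw W pU pX) (fun ω => (ω.1.1, ω.1.2)) (u, x) =
      prob (auxLaw W pU pX) (fun ω => ω.1.1) u * q (e.symm u) x := fun u x => by rw [hUX, hU]
  have hsum : ∀ F : (X → ℝ) → ℝ, ∑ u, prob (auxLaw W pU pX) (fun ω => ω.1.1) u *
      F (q (e.symm u)) = ∑ i, w i * F (q i) := by
    intro F
    simp only [hU]
    exact e.symm.sum_comp fun i => w i * F (q i)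
  have hX : prob (auxLaw W pU pX) (fun ω => ω.1.2) = ∑ i, w i • q i := by
    rw [prob_eq_sum_smul hUX']
    simp only [hU]
    exact e.symm.sum_comp fun i => w i • q i
  have hout1a : IsOutput (auxLaw W pU pX) (fun ω => ω.1.1) (fun ω => ω.1.2) W (fun y => y.1)
      (fun ω => ω.2.1) :=
    isOutput_joint (joint pU pX) W (fun a => a.2) (fun a => a.1) fun y => y.1
  have hout1b : IsOutput (auxLaw W pU pX) (fun ω => ω.1.1) (fun ω => ω.1.2) W (fun y => y.2.1)
      (fun ω => ω.2.2.1) :=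
    isOutput_joint (joint pU pX) W (fun a => a.2) (fun a => a.1) fun y => y.2.1
  have hout2a : IsOutput (auxLaw W pU pX) (fun ω => ω.1.1) (fun ω => ω.1.2) W (fun y => y.2.2.1)
      (fun ω => ω.2.2.2.1) :=
    isOutput_joint (joint pU pX) W (fun a => a.2) (fun a => a.1) fun y => y.2.2.1
  have hout2b : IsOutput (auxLaw W pU pX) (fun ω => ω.1.1) (fun ω => ω.1.2) W (fun y => y.2.2.2)
      (fun ω => ω.2.2.2.2) :=
    isOutput_joint (joint pU pX) W (fun a => a.2) (fun a => a.1) fun y => y.2.2.2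
  have hq' := fun u => hq (e.symm u)
  simp only [← hqz, infoVector, Prod.smul_mk, Prod.fst_sum, Prod.snd_sum, smul_eq_mul]
    at hb hd ha hc
  refine ⟨h0, h1, h2, Fintype.card ι, pU, pX, le_min ?_ ?_, ?_, ?_⟩
  · rwa [mutualInfo_eq_of_isOutput hout1b hq' hUX', hX,
      hsum (outputEntropy W fun y => y.2.1)]
  · rwa [mutualInfo_eq_of_isOutput hout2b hq' hUX', hX,
      hsum (outputEntropy W fun y => y.2.2.2)]
  · rwa [condMutualInfo_eq_of_isOutput hout1a hq' hUX',
      condMutualInfo_eq_of_isOutput hout2b hq' hUX',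
      hsum fun r => outputEntropy W (fun y => y.1) r - noiseEntropy W (fun y => y.1) r,
      hsum fun r => outputEntropy W (fun y => y.2.2.2) r - noiseEntropy W (fun y => y.2.2.2) r,
      ← Finset.sum_sub_distrib, Finset.sum_congr rfl fun i _ => (mul_sub (w i) _ _).symm]
  · rwa [condMutualInfo_eq_of_isOutput hout2a hq' hUX',
      condMutualInfo_eq_of_isOutput hout1b hq' hUX',
      hsum fun r => outputEntropy W (fun y => y.2.2.1) r - noiseEntropy W (fun y => y.2.2.1) r,
      hsum fun r => outputEntropy W (fun y => y.2.1) r - noiseEntropy W (fun y => y.2.1) r,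
      ← Finset.sum_sub_distrib, Finset.sum_congr rfl fun i _ => (mul_sub (w i) _ _).symm]

/-- By compactness, a rate triple is in the outer region if it satisfies the bounds up to every
positive error, each time with an auxiliary variable of its own. -/
lemma mem_outerRegion_of_forall_pos {R : ℝ × ℝ × ℝ} (h0 : 0 ≤ R.1) (h1 : 0 ≤ R.2.1)
    (h2 : 0 ≤ R.2.2)
    (h : ∀ ε > 0, ∃ t ∈ infoRegion W,
      R.1 - ε ≤ outputEntropy W (fun y => y.2.1) t.1 - t.2.1 ∧
      R.1 - ε ≤ outputEntropy W (fun y => y.2.2.2) t.1 - t.2.2.1 ∧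
      R.2.1 - ε ≤ t.2.2.2.1 ∧ R.2.2 - ε ≤ t.2.2.2.2) : R ∈ outerRegion W := by
  -- The smallest slack in the four bounds attains its maximum.
  let slack : (X → ℝ) × ℝ × ℝ × ℝ × ℝ → ℝ := fun t =>
    min (min (outputEntropy W (fun y => y.2.1) t.1 - t.2.1 - R.1)
      (outputEntropy W (fun y => y.2.2.2) t.1 - t.2.2.1 - R.1))
      (min (t.2.2.2.1 - R.2.1) (t.2.2.2.2 - R.2.2))
  have hcont : Continuous slack := by
    have c1 := continuous_outputEntropy W fun y => y.2.1
    have c2 := continuous_outputEntropy W fun y => y.2.2.2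
    fun_prop
  obtain ⟨t₁, ht₁, -⟩ := h 1 one_pos
  obtain ⟨t, ht, hmax⟩ := (isCompact_infoRegion W).exists_isMaxOn ⟨t₁, ht₁⟩ hcont.continuousOn
  have hslack : 0 ≤ slack t := by
    refine le_of_forall_pos_le_add fun ε hε => ?_
    obtain ⟨s, hs, hb, hd, ha, hc⟩ := h ε hε
    have hs' : -ε ≤ slack s := by
      simp only [slack, le_min_iff]
      refine ⟨⟨?_, ?_⟩, ?_, ?_⟩ <;> linarith
    have := hmax hs
    simp only [Set.mem_ofPred_eq] at this
    linarith
  simp only [slack, le_min_iff, sub_nonneg] at hslack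
  obtain ⟨⟨hb, hd⟩, ha, hc⟩ := hslack
  exact mem_outerRegion_of_mem_infoRegion W h0 h1 h2 ht hb hd ha hc

end Region

/-! ### Chain rules over a block -/

section ChainRule

variable {Ω σ ζ : Type*} {n : ℕ}

/-- The first `k` letters of a word of length `n`, the other letters being erased. -/
def past (y : Fin n → ζ) (k : ℕ) : Fin n → Option ζ := fun j => if j.1 < k then some (y j) else none

lemma past_eq_iff (y y' : Fin n → ζ) (k : ℕ) :
    past y k = past y' k ↔ ∀ j : Fin n, j.1 < k → y j = y' j := by
  rw [funext_iff]
  refine forall_congr' fun j => ?_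
  by_cases h : j.1 < k <;> simp [past, h]

lemma past_succ_eq_iff (y y' : Fin n → ζ) (i : Fin n) :
    past y (i.1 + 1) = past y' (i.1 + 1) ↔ past y i.1 = past y' i.1 ∧ y i = y' i := by
  simp only [past_eq_iff, Nat.lt_succ_iff_lt_or_eq]
  constructor
  · exact fun h => ⟨fun j hj => h j (Or.inl hj), h i (Or.inr rfl)⟩
  · rintro ⟨h1, h2⟩ j (hj | hj)
    · exact h1 j hj
    · rwa [Fin.ext hj]

/-- The chain rule `H(Yⁿ | S) = ∑ᵢ H(Yᵢ | S, Y₁, …, Yᵢ₋₁)`. -/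
lemma entropy_chain_rule [Fintype Ω] [Fintype σ] [Fintype ζ] (p : PMF Ω) (S : Ω → σ)
    (Y : Ω → Fin n → ζ) :
    entropy p (fun ω => (S ω, Y ω)) - entropy p S =
      ∑ i : Fin n, (entropy p (fun ω => (S ω, past (Y ω) i.1, Y ω i)) -
        entropy p (fun ω => (S ω, past (Y ω) i.1))) := by
  set F : ℕ → ℝ := fun k => entropy p (fun ω => (S ω, past (Y ω) k)) with hF
  have h1 : ∀ i : Fin n, entropy p (fun ω => (S ω, past (Y ω) i.1, Y ω i)) = F (i.1 + 1) :=
    fun i => entropy_congr p fun ω ω' => by simp only [Prod.mk.injEq, past_succ_eq_iff]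
  have h2 : entropy p (fun ω => (S ω, Y ω)) = F n := entropy_congr p fun ω ω' => by
    rw [Prod.mk.injEq, Prod.mk.injEq, past_eq_iff, funext_iff]
    simp
  have h3 : entropy p S = F 0 := entropy_congr p fun ω ω' => by simp [past_eq_iff]
  simp only [h1]
  rw [h2, h3, Fin.sum_univ_eq_sum_range (fun i => F (i + 1) - F i) n, Finset.sum_range_sub]

end ChainRule

section Converse

variable {M X Y α β ζ η δ : Type*} {n : ℕ} [Fintype M] [Fintype X] [Fintype Y] [Fintype α]
  [Fintype β] [Fintype ζ] [Fintype η] [Fintype δ]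

/-- `H(f(Y)ⁿ | M, Xⁿ) = ∑ᵢ H(f(Yᵢ) | Xᵢ)` over a memoryless channel. -/
lemma entropy_memoryless (p : PMF (M × (Fin n → X))) (W : X → PMF Y) (f : Y → ζ) :
    entropy (joint p fun a => memoryless W n a.2) (fun ω => (ω.1, fun i => f (ω.2 i))) -
        entropy (joint p fun a => memoryless W n a.2) (fun ω => ω.1) =
      ∑ i, noiseEntropy W f (prob (joint p fun a => memoryless W n a.2) fun ω => ω.1.2 i) := by
  rw [entropy_chain_rule]
  refine Finset.sum_congr rfl fun i _ => ?_
  have h := (isOutput_memoryless p W i (fun ω => (ω.1, past (fun i => f (ω.2 i)) i.1))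
    (fun a y z => by
      refine Prod.ext rfl ((past_eq_iff _ _ _).2 fun j hj => ?_)
      change f (Function.update y i z j) = f (y j)
      rw [Function.update_of_ne (Fin.ne_of_lt hj)]) f).entropy_triple
  rw [sub_eq_iff_eq_add']
  refine Eq.trans ?_ (h.trans ?_)
  · refine entropy_congr _ fun ω ω' => ?_
    simp only [Prod.mk.injEq]
    constructor
    · rintro ⟨h1, h2, h3⟩
      exact ⟨⟨h1, h2⟩, by rw [h1], h3⟩
    · rintro ⟨⟨h1, h2⟩, -, h3⟩
      exact ⟨h1, h2, h3⟩
  · congr 1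
    refine entropy_congr _ fun ω ω' => ?_
    simp only [Prod.mk.injEq]
    constructor
    · exact fun h => h.1
    · exact fun h => ⟨h, by rw [h.1]⟩

/-- `I(W₀; Bⁿ) ≤ ∑ᵢ I(Uᵢ; Bᵢ)` for `Uᵢ = (W₀, G₁, …, Gᵢ₋₁)`, when each `Gᵢ` determines `Bᵢ`. -/
lemma mutualInfo_le_sum {Ω : Type*} [Fintype Ω] (p : PMF Ω) (W₀ : Ω → α) (G : Ω → Fin n → η)
    (b : η → β) :
    mutualInfo p W₀ (fun ω i => b (G ω i)) ≤
      ∑ i : Fin n, mutualInfo p (fun ω => (W₀ ω, past (G ω) i.1)) fun ω => b (G ω i) := by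
  set B : Ω → Fin n → β := fun ω i => b (G ω i) with hB
  have hpast : ∀ ω ω' k, past (G ω) k = past (G ω') k → past (B ω) k = past (B ω') k := by
    intro ω ω' k h
    rw [past_eq_iff] at h ⊢
    exact fun j hj => congrArg b (h j hj)
  have h1 := entropy_chain_rule p (fun _ => ()) B
  have h2 := entropy_chain_rule p W₀ B
  have h3 : entropy p (fun ω => ((), B ω)) = entropy p B := entropy_congr p (by simp)
  have h4 : entropy p (fun _ : Ω => ()) = 0 := entropy_of_subsingleton p _
  rw [h3, h4, sub_zero] at h1
  have key : mutualInfo p W₀ B = ∑ i : Fin n,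
      ((entropy p (fun ω => ((), past (B ω) i.1, B ω i)) -
        entropy p (fun ω => ((), past (B ω) i.1))) -
      (entropy p (fun ω => (W₀ ω, past (B ω) i.1, B ω i)) -
        entropy p (fun ω => (W₀ ω, past (B ω) i.1)))) := by
    rw [Finset.sum_sub_distrib, ← h1, ← h2, mutualInfo]
    ring
  rw [key]
  refine Finset.sum_le_sum fun i _ => ?_
  have s1 := entropy_add_le_of_factorsThrough p (fun ω => ((), past (B ω) i.1, B ω i))
    (fun _ => ()) (fun ω => ((), past (B ω) i.1)) (fun ω => B ω i)
    (fun _ _ _ => rfl) (fun _ _ _ => rfl) (by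
      intro ω ω' h
      simp only [Prod.mk.injEq, true_and] at h ⊢
      exact h)
  have s2 := entropy_add_le_of_factorsThrough p (fun ω => ((W₀ ω, past (G ω) i.1), B ω i))
    (fun ω => (W₀ ω, past (B ω) i.1)) (fun ω => (W₀ ω, past (B ω) i.1, B ω i))
    (fun ω => (W₀ ω, past (G ω) i.1))
    (by
      intro ω ω' h
      simp only [Prod.mk.injEq] at h ⊢
      exact ⟨h.1, h.2.1⟩)
    (by
      intro ω ω' h
      simp only [Prod.mk.injEq] at h ⊢
      exact ⟨h.1, hpast _ _ _ h.2⟩)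
    (by
      intro ω ω' h
      simp only [Prod.mk.injEq] at h ⊢
      exact ⟨h.2, h.1.2.2⟩)
  rw [mutualInfo]
  simp only [hB] at s1 s2 h4 ⊢
  linarith

/-- The secrecy converse before single-letterization. If `W₁` is decoded from `A` and hidden from
`D`, its uncertainty given `D` is at most the uncertainty of `W₀` given `D`, that of `W₁` given `A`,
and `I(W₁; V | D, W₀)` for any `V` that determines `A`. -/
lemma condEntropy_le {Ω κ : Type*} [Fintype Ω] [Fintype κ] (p : PMF Ω) (W₀ : Ω → α) (W₁ : Ω → β)
    (A : Ω → ζ) (D : Ω → δ) (V : Ω → κ) (hA : A.FactorsThrough V) :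
    condEntropy p W₁ D ≤ condEntropy p W₀ D + condEntropy p W₁ A +
      ((entropy p (fun ω => ((D ω, W₀ ω), V ω)) - entropy p (fun ω => (D ω, W₀ ω))) -
      (entropy p (fun ω => ((D ω, W₀ ω, W₁ ω), V ω)) - entropy p (fun ω => (D ω, W₀ ω, W₁ ω)))) := by
  have s1 := entropy_add_le_of_factorsThrough p (fun ω => ((D ω, W₀ ω, W₁ ω), V ω)) A
    (fun ω => (W₁ ω, A ω)) (fun ω => ((D ω, W₀ ω), V ω))
    (by
      intro ω ω' h
      exact (Prod.ext_iff.1 h).2)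
    (by
      intro ω ω' h
      exact hA (Prod.ext_iff.1 h).2)
    (by
      intro ω ω' h
      simp only [Prod.mk.injEq] at h ⊢
      tauto)
  have s2 : entropy p (fun ω => (W₁ ω, D ω)) ≤ entropy p (fun ω => (D ω, W₀ ω, W₁ ω)) :=
    entropy_le_of_factorsThrough p (by
      intro ω ω' h
      simp only [Prod.mk.injEq] at h ⊢
      tauto)
  have s3 : entropy p (fun ω => (W₀ ω, D ω)) = entropy p (fun ω => (D ω, W₀ ω)) :=
    entropy_congr p (by
      intro ω ω'
      simp only [Prod.mk.injEq]
      tauto)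
  simp only [condEntropy]
  linarith

/-- Single-letterization of `I(W₁; (A, G)ⁿ | Dⁿ, W₀)`, with `Uᵢ = (W₀, G₁, …, Gᵢ₋₁)`. -/
lemma condInfo_le_sum (p : PMF (M × (Fin n → X))) (W : X → PMF Y) (w₀ : M → α) (w₁ : M → β)
    (f : Y → ζ) (g : Y → η) (d : η → δ) {μ : PMF ((M × (Fin n → X)) × (Fin n → Y))}
    (hμ : μ = joint p fun a => memoryless W n a.2) :
    (entropy μ (fun ω => (((fun i => d (g (ω.2 i))), w₀ ω.1.1),
          fun i => (f (ω.2 i), g (ω.2 i)))) -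
        entropy μ (fun ω => ((fun i => d (g (ω.2 i))), w₀ ω.1.1))) -
      (entropy μ (fun ω => (((fun i => d (g (ω.2 i))), w₀ ω.1.1, w₁ ω.1.1),
          fun i => (f (ω.2 i), g (ω.2 i)))) -
        entropy μ (fun ω => ((fun i => d (g (ω.2 i))), w₀ ω.1.1, w₁ ω.1.1))) ≤
    ∑ i : Fin n,
      ((entropy μ (fun ω => ((w₀ ω.1.1, past (fun i => g (ω.2 i)) i.1), (f (ω.2 i), g (ω.2 i)))) -
          noiseEntropy W (fun y => (f y, g y)) (prob μ fun ω => ω.1.2 i)) -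
        (entropy μ (fun ω => ((w₀ ω.1.1, past (fun i => g (ω.2 i)) i.1), d (g (ω.2 i)))) -
          noiseEntropy W (fun y => d (g y)) (prob μ fun ω => ω.1.2 i))) := by
  subst hμ
  set μ := joint p fun a => memoryless W n a.2 with hμ
  have hV := entropy_memoryless p W (fun y => (f y, g y))
  have hD := entropy_memoryless p W (fun y => d (g y))
  rw [← hμ] at hV hD
  -- Conditioning on all messages and inputs can only decrease the last two terms.
  have s1 := entropy_add_le_of_factorsThrough μ (fun ω => (ω.1, fun i => (f (ω.2 i), g (ω.2 i))))
    (fun ω => ((fun i => d (g (ω.2 i))), w₀ ω.1.1, w₁ ω.1.1))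
    (fun ω => (((fun i => d (g (ω.2 i))), w₀ ω.1.1, w₁ ω.1.1),
          fun i => (f (ω.2 i), g (ω.2 i))))
    (fun ω => (ω.1, fun i => d (g (ω.2 i))))
    (by
      intro ω ω' h
      exact (Prod.ext_iff.1 h).1)
    (by
      intro ω ω' h
      simp only [Prod.mk.injEq] at h ⊢
      exact ⟨h.2, by rw [h.1], by rw [h.1]⟩)
    (by
      intro ω ω' h
      simp only [Prod.mk.injEq] at h ⊢
      exact ⟨h.2.1, h.1.2⟩)
  have s2 := entropy_chain_rule μ (fun ω => ((fun i => d (g (ω.2 i))), w₀ ω.1.1))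
    (fun ω i => (f (ω.2 i), g (ω.2 i)))
  have s3 : ∀ i : Fin n,
      entropy μ (fun ω => (((fun i => d (g (ω.2 i))), w₀ ω.1.1),
          past (fun i => (f (ω.2 i), g (ω.2 i))) i.1, (f (ω.2 i), g (ω.2 i)))) -
        entropy μ (fun ω => (((fun i => d (g (ω.2 i))), w₀ ω.1.1),
          past (fun i => (f (ω.2 i), g (ω.2 i))) i.1)) ≤
      entropy μ (fun ω => ((w₀ ω.1.1, past (fun i => g (ω.2 i)) i.1), (f (ω.2 i), g (ω.2 i)))) -
        entropy μ (fun ω => ((w₀ ω.1.1, past (fun i => g (ω.2 i)) i.1), d (g (ω.2 i)))) := by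
    intro i
    have := entropy_add_le_of_factorsThrough μ
      (fun ω => (((fun i => d (g (ω.2 i))), w₀ ω.1.1),
          past (fun i => (f (ω.2 i), g (ω.2 i))) i.1, (f (ω.2 i), g (ω.2 i))))
      (fun ω => ((w₀ ω.1.1, past (fun i => g (ω.2 i)) i.1), d (g (ω.2 i))))
      (fun ω => ((w₀ ω.1.1, past (fun i => g (ω.2 i)) i.1), (f (ω.2 i), g (ω.2 i))))
      (fun ω => (((fun i => d (g (ω.2 i))), w₀ ω.1.1),
          past (fun i => (f (ω.2 i), g (ω.2 i))) i.1))
      (by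
        intro ω ω' h
        simp only [Prod.mk.injEq] at h ⊢
        exact ⟨h.1, by rw [h.2.2]⟩)
      (by
        intro ω ω' h
        simp only [Prod.mk.injEq, past_eq_iff] at h ⊢
        exact ⟨⟨h.1.2, fun j hj => (h.2 j hj).2⟩, congrFun h.1.1 i⟩)
      (by
        intro ω ω' h
        simp only [Prod.mk.injEq] at h ⊢
        exact ⟨h.2.1, h.2.2, h.1.2⟩)
    linarith
  have s4 := Finset.sum_le_sum fun i (_ : i ∈ Finset.univ) => s3 i
  rw [← s2] at s4
  simp only [Finset.sum_sub_distrib] at s4 ⊢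
  linarith

end Converse

/-! ### Single-letter converse -/

section ConverseSingleLetter

/-- The `i`-th output of a memoryless channel, given its input, is independent of the messages and
of the past outputs. -/
lemma isOutput_past {M X Y α ζ η : Type*} {n : ℕ} [Fintype M] [Fintype X] [Fintype Y]
    (p : PMF (M × (Fin n → X))) (W : X → PMF Y) (w₀ : M → α) (g : Y → η)
    (f : Y → ζ) (i : Fin n) :
    IsOutput (joint p fun a => memoryless W n a.2)
      (fun ω => (w₀ ω.1.1, past (fun i => g (ω.2 i)) i.1)) (fun ω => ω.1.2 i) W f
      (fun ω => f (ω.2 i)) :=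
  isOutput_memoryless p W i _ (fun a y z => by
    refine Prod.ext rfl ((past_eq_iff _ _ _).2 fun j hj => ?_)
    change g (Function.update y i z j) = g (y j)
    rw [Function.update_of_ne (Fin.ne_of_lt hj)]) f

variable {M X Y α β ζ η δ : Type*} {n : ℕ} [Fintype M] [Fintype X] [Fintype Y] [Fintype α]
  [Fintype β] [Fintype ζ] [Fintype η] [Fintype δ]

/-- The single-letter converse for the common message. -/
lemma mutualInfo_le_sum_outputEntropy (p : PMF (M × (Fin n → X))) (W : X → PMF Y) (w₀ : M → α)
    (g : Y → η) (b : η → β) {μ : PMF ((M × (Fin n → X)) × (Fin n → Y))}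
    (hμ : μ = joint p fun a => memoryless W n a.2)
    {q : ∀ _ : Fin n, α × (Fin n → Option η) → X → ℝ} (hq : ∀ i u, q i u ∈ stdSimplex ℝ X)
    (hU : ∀ i u x,
      prob μ (fun ω => ((w₀ ω.1.1, past (fun i => g (ω.2 i)) i.1), ω.1.2 i)) (u, x) =
        prob μ (fun ω => (w₀ ω.1.1, past (fun i => g (ω.2 i)) i.1)) u * q i u x) :
    mutualInfo μ (fun ω => w₀ ω.1.1) (fun ω i => b (g (ω.2 i))) ≤
      ∑ i : Fin n, outputEntropy W (fun y => b (g y)) (prob μ fun ω => ω.1.2 i) -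
      ∑ i : Fin n, ∑ u, prob μ (fun ω => (w₀ ω.1.1, past (fun i => g (ω.2 i)) i.1)) u *
        outputEntropy W (fun y => b (g y)) (q i u) := by
  rw [← Finset.sum_sub_distrib]
  refine (mutualInfo_le_sum μ (fun ω => w₀ ω.1.1) (fun ω i => g (ω.2 i)) b).trans_eq ?_
  refine Finset.sum_congr rfl fun i _ => ?_
  have o := isOutput_past p W w₀ g (fun y => b (g y)) i
  rw [← hμ] at o
  exact mutualInfo_eq_of_isOutput o (hq i) (hU i)

/-- The single-letter secrecy converse. -/
lemma condEntropy_le_sum (p : PMF (M × (Fin n → X))) (W : X → PMF Y) (w₀ : M → α) (w₁ : M → β)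
    (f : Y → ζ) (g : Y → η) (d : η → δ)
    (h : ∀ r : PMF X, IsMarkovChain (joint r W) (fun ω => ω.1) (fun ω => f ω.2) fun ω => g ω.2)
    {μ : PMF ((M × (Fin n → X)) × (Fin n → Y))} (hμ : μ = joint p fun a => memoryless W n a.2)
    {q : ∀ _ : Fin n, α × (Fin n → Option η) → X → ℝ} (hq : ∀ i u, q i u ∈ stdSimplex ℝ X)
    (hU : ∀ i u x,
      prob μ (fun ω => ((w₀ ω.1.1, past (fun i => g (ω.2 i)) i.1), ω.1.2 i)) (u, x) =
        prob μ (fun ω => (w₀ ω.1.1, past (fun i => g (ω.2 i)) i.1)) u * q i u x) :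
    condEntropy μ (fun ω => w₁ ω.1.1) (fun ω i => d (g (ω.2 i))) ≤
      condEntropy μ (fun ω => w₀ ω.1.1) (fun ω i => d (g (ω.2 i))) +
      condEntropy μ (fun ω => w₁ ω.1.1) (fun ω i => f (ω.2 i)) +
      ∑ i : Fin n, ∑ u, prob μ (fun ω => (w₀ ω.1.1, past (fun i => g (ω.2 i)) i.1)) u *
        ((outputEntropy W f (q i u) - noiseEntropy W f (q i u)) -
          (outputEntropy W (fun y => d (g y)) (q i u) -
            noiseEntropy W (fun y => d (g y)) (q i u))) := by
  have s1 := condEntropy_le μ (fun ω => w₀ ω.1.1) (fun ω => w₁ ω.1.1) (fun ω i => f (ω.2 i))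
    (fun ω i => d (g (ω.2 i))) (fun ω i => (f (ω.2 i), g (ω.2 i)))
    (by
      intro ω ω' h
      funext i
      exact (Prod.ext_iff.1 (congrFun h i)).1)
  have s2 := condInfo_le_sum p W w₀ w₁ f g d hμ
  refine s1.trans (add_le_add_right (s2.trans_eq ?_) _)
  refine Finset.sum_congr rfl fun i _ => ?_
  have o1 := isOutput_past p W w₀ g (fun y => (f y, g y)) i
  have o2 := isOutput_past p W w₀ g (fun y => d (g y)) i
  rw [← hμ] at o1 o2
  rw [o1.entropy_pair (q i) (hq i) (hU i), o2.entropy_pair (q i) (hq i) (hU i),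
    prob_eq_sum_smul (hU i), noiseEntropy_sum_smul, noiseEntropy_sum_smul]
  simp_rw [← outputEntropy_sub_noiseEntropy_of_isMarkovChain W f g h (hq i _)]
  simp only [mul_sub, Finset.sum_sub_distrib]
  ring

end ConverseSingleLetter

/-! ### Codes of finite block length -/

section Codes

variable {X Y1a Y1b Y2a Y2b : Type*} {n : ℕ}
  [Fintype X] [Fintype Y1a] [Fintype Y1b] [Fintype Y2a] [Fintype Y2b]
  (W : X → PMF (Y1a × Y1b × Y2a × Y2b)) (c : Code X Y1a Y1b Y2a Y2b n)

lemma prob_law_message {α : Type*} (w : Fin c.M₀ × Fin c.M₁ × Fin c.M₂ → α) (a : α) :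
    prob (c.law W) (fun ω => w ω.1.1) a = prob (PMF.uniformOfFintype _) w a := by
  rw [Code.law, prob_joint_fst (joint (PMF.uniformOfFintype _) c.enc)
    (fun a => memoryless W n a.2) (fun a => w a.1), prob_joint_fst]

lemma entropy_W0 : entropy (c.law W) c.W0 = Real.log c.M₀ := by
  have h := entropy_eq_log_card (c.law W) c.W0 fun a => by
    refine (prob_law_message W c (fun m => m.1) a).trans ?_
    have h0 : (c.M₀ : ℝ) ≠ 0 := NeZero.ne _
    have h1 : (c.M₁ : ℝ) ≠ 0 := NeZero.ne _
    have h2 : (c.M₂ : ℝ) ≠ 0 := NeZero.ne _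
    rw [prob_eq_sum_mul, Fintype.sum_prod_type]
    simp_rw [Fintype.sum_prod_type]
    change ∑ x : Fin c.M₀, ∑ y : Fin c.M₁, ∑ z : Fin c.M₂,
      (PMF.uniformOfFintype (Fin c.M₀ × Fin c.M₁ × Fin c.M₂) (x, y, z)).toReal *
        (if x = a then 1 else 0) = _
    simp
    field_simp
  simpa using h

lemma entropy_W1 : entropy (c.law W) c.W1 = Real.log c.M₁ := by
  have h := entropy_eq_log_card (c.law W) c.W1 fun a => by
    refine (prob_law_message W c (fun m => m.2.1) a).trans ?_
    have h0 : (c.M₀ : ℝ) ≠ 0 := NeZero.ne _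
    have h1 : (c.M₁ : ℝ) ≠ 0 := NeZero.ne _
    have h2 : (c.M₂ : ℝ) ≠ 0 := NeZero.ne _
    rw [prob_eq_sum_mul, Fintype.sum_prod_type]
    simp_rw [Fintype.sum_prod_type]
    change ∑ x : Fin c.M₀, ∑ y : Fin c.M₁, ∑ z : Fin c.M₂,
      (PMF.uniformOfFintype (Fin c.M₀ × Fin c.M₁ × Fin c.M₂) (x, y, z)).toReal *
        (if y = a then 1 else 0) = _
    simp
    field_simp
  simpa using h

lemma entropy_W2 : entropy (c.law W) c.W2 = Real.log c.M₂ := by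
  have h := entropy_eq_log_card (c.law W) c.W2 fun a => by
    refine (prob_law_message W c (fun m => m.2.2) a).trans ?_
    have h0 : (c.M₀ : ℝ) ≠ 0 := NeZero.ne _
    have h1 : (c.M₁ : ℝ) ≠ 0 := NeZero.ne _
    have h2 : (c.M₂ : ℝ) ≠ 0 := NeZero.ne _
    rw [prob_eq_sum_mul, Fintype.sum_prod_type]
    simp_rw [Fintype.sum_prod_type]
    change ∑ x : Fin c.M₀, ∑ y : Fin c.M₁, ∑ z : Fin c.M₂,
      (PMF.uniformOfFintype (Fin c.M₀ × Fin c.M₁ × Fin c.M₂) (x, y, z)).toReal *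
        (if z = a then 1 else 0) = _
    simp
    field_simp
  simpa using h

/-- Fano's inequality for a message of a code, in terms of the overall error probability. -/
lemma condEntropy_le_errorProb {β : Type*} [Fintype β] {m : ℕ} (V : c.Sample → Fin m)
    (Y : c.Sample → β) (dec : β → Fin m)
    (hdec : ∀ ω, dec (Y ω) ≠ V ω → c.dec1b (c.out1b ω) ≠ c.W0 ω ∨ c.dec2b (c.out2b ω) ≠ c.W0 ω ∨
      c.dec1a (c.out1a ω) ≠ c.W1 ω ∨ c.dec2a (c.out2a ω) ≠ c.W2 ω) :
    condEntropy (c.law W) V Y ≤ Real.log 2 + c.errorProb W * Real.log m := by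
  classical
  have h := fano (c.law W) V Y dec
  rw [Fintype.card_fin] at h
  refine h.trans (add_le_add_right (mul_le_mul_of_nonneg_right ?_ (Real.log_natCast_nonneg m)) _)
  rw [Code.errorProb, PMF.toOuterMeasure_apply_fintype, ENNReal.toReal_sum]
  · refine Finset.sum_le_sum fun ω _ => ?_
    by_cases hω : dec (Y ω) ≠ V ω
    · rw [if_pos hω, Set.indicator_of_mem]
      exact hdec ω hω
    · rw [if_neg hω]
      exact ENNReal.toReal_nonneg
  · intro ω _
    rw [Set.indicator_apply]
    split_ifs
    · exact PMF.apply_ne_top _ ω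
    · exact ENNReal.zero_ne_top

lemma mutualInfo_eq_entropy_sub_condEntropy {Ω α β : Type*} [Fintype α] [Fintype β]
    (p : PMF Ω) (V : Ω → α) (Y : Ω → β) :
    mutualInfo p V Y = entropy p V - condEntropy p V Y := by
  rw [mutualInfo, condEntropy]
  ring

/-- Time sharing: an average over `n` letters of convex combinations is a point of `infoRegion`,
and output entropies only grow when the input laws are averaged. -/
lemma exists_mem_infoRegion_of_sum {α : Type*} [Fintype α] (hn : 0 < n) {w : Fin n → α → ℝ}
    (hw : ∀ i, w i ∈ stdSimplex ℝ α) {q : Fin n → α → X → ℝ}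
    (hq : ∀ i u, q i u ∈ stdSimplex ℝ X) {r : Fin n → X → ℝ}
    (hr : ∀ i, r i = ∑ u, w i u • q i u) :
    ∃ t ∈ infoRegion W,
      ∑ i, outputEntropy W (fun y => y.2.1) (r i) -
          ∑ i, ∑ u, w i u * outputEntropy W (fun y => y.2.1) (q i u) ≤
        n * (outputEntropy W (fun y => y.2.1) t.1 - t.2.1) ∧
      ∑ i, outputEntropy W (fun y => y.2.2.2) (r i) -
          ∑ i, ∑ u, w i u * outputEntropy W (fun y => y.2.2.2) (q i u) ≤
        n * (outputEntropy W (fun y => y.2.2.2) t.1 - t.2.2.1) ∧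
      n * t.2.2.2.1 = ∑ i, ∑ u, w i u *
        ((outputEntropy W (fun y => y.1) (q i u) - noiseEntropy W (fun y => y.1) (q i u)) -
          (outputEntropy W (fun y => y.2.2.2) (q i u) -
            noiseEntropy W (fun y => y.2.2.2) (q i u))) ∧
      n * t.2.2.2.2 = ∑ i, ∑ u, w i u *
        ((outputEntropy W (fun y => y.2.2.1) (q i u) - noiseEntropy W (fun y => y.2.2.1) (q i u)) -
          (outputEntropy W (fun y => y.2.1) (q i u) -
            noiseEntropy W (fun y => y.2.1) (q i u))) := by
  have hn' : (0 : ℝ) < n := by exact_mod_cast hn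
  let t : (X → ℝ) × ℝ × ℝ × ℝ × ℝ :=
    ∑ i : Fin n, (n : ℝ)⁻¹ • ∑ u, w i u • infoVector W (q i u)
  have hn1 : ∑ _i : Fin n, (n : ℝ)⁻¹ = 1 := by
    simp only [Finset.sum_const, Finset.card_univ, Fintype.card_fin, nsmul_eq_mul]
    exact mul_inv_cancel₀ hn'.ne'
  have ht : t ∈ infoRegion W := by
    refine (convex_convexHull ℝ _).sum_mem (fun _ _ => inv_nonneg.2 hn'.le) hn1 fun i _ => ?_
    exact (convex_convexHull ℝ _).sum_mem (fun u _ => (hw i).1 u) (hw i).2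
      fun u _ => subset_convexHull ℝ _ ⟨q i u, hq i u, rfl⟩
  have hr' : ∀ i, r i ∈ stdSimplex ℝ X := fun i => by
    rw [hr]
    exact (convex_stdSimplex ℝ X).sum_mem (fun u _ => (hw i).1 u) (hw i).2 fun u _ => hq i u
  have ht1 : t.1 = ∑ i : Fin n, (n : ℝ)⁻¹ • r i := by
    simp only [t, infoVector, Prod.fst_sum, Prod.smul_fst, hr]
  have hsum : ∀ F : (X → ℝ) → ℝ, n * ∑ i : Fin n, (n : ℝ)⁻¹ * ∑ u, w i u * F (q i u) =
      ∑ i : Fin n, ∑ u, w i u * F (q i u) := by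
    intro F
    rw [← Finset.mul_sum, mul_inv_cancel_left₀ hn'.ne']
  have hconc : ∀ F : (X → ℝ) → ℝ, ConcaveOn ℝ (stdSimplex ℝ X) F →
      ∑ i : Fin n, F (r i) ≤ n * F t.1 := by
    intro F hF
    have := hF.le_map_sum (t := Finset.univ) (w := fun _ : Fin n => (n : ℝ)⁻¹) (p := r)
      (fun _ _ => inv_nonneg.2 hn'.le) hn1 fun i _ => hr' i
    rw [← ht1] at this
    simp only [smul_eq_mul, ← Finset.mul_sum] at this
    rwa [inv_mul_le_iff₀ hn'] at this
  refine ⟨t, ht, ?_, ?_, ?_, ?_⟩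
  · rw [mul_sub, ← hsum (outputEntropy W fun y => y.2.1)]
    refine sub_le_sub (hconc _ (concaveOn_outputEntropy W fun y => y.2.1)) (le_of_eq ?_)
    simp only [t, infoVector, Prod.fst_sum, Prod.snd_sum, Prod.smul_fst, Prod.smul_snd,
      smul_eq_mul]
  · rw [mul_sub, ← hsum (outputEntropy W fun y => y.2.2.2)]
    refine sub_le_sub (hconc _ (concaveOn_outputEntropy W fun y => y.2.2.2)) (le_of_eq ?_)
    simp only [t, infoVector, Prod.fst_sum, Prod.snd_sum, Prod.smul_fst, Prod.smul_snd,
      smul_eq_mul]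
  · refine Eq.trans ?_ (hsum fun r => (infoVector W r).2.2.2.1)
    simp only [t, Prod.fst_sum, Prod.snd_sum, Prod.smul_fst, Prod.smul_snd, smul_eq_mul]
  · refine Eq.trans ?_ (hsum fun r => (infoVector W r).2.2.2.2)
    simp only [t, Prod.snd_sum, Prod.smul_snd, smul_eq_mul]

/-- The finite block length converse: the rates of every code are bounded, up to error and leakage
terms, by a point of `infoRegion`. -/
lemma exists_mem_infoRegion (hn : 0 < n)
    (h1 : ∀ p : PMF X, IsMarkovChain (joint p W)
      (fun ω => ω.1) (fun ω => ω.2.1) (fun ω => (ω.2.2.1, ω.2.2.2.2)))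
    (h2 : ∀ p : PMF X, IsMarkovChain (joint p W)
      (fun ω => ω.1) (fun ω => ω.2.2.2.1) (fun ω => (ω.2.2.1, ω.2.2.2.2))) :
    ∃ t ∈ infoRegion W,
      Real.log c.M₀ - (Real.log 2 + c.errorProb W * Real.log c.M₀) ≤
        n * (outputEntropy W (fun y => y.2.1) t.1 - t.2.1) ∧
      Real.log c.M₀ - (Real.log 2 + c.errorProb W * Real.log c.M₀) ≤
        n * (outputEntropy W (fun y => y.2.2.2) t.1 - t.2.2.1) ∧
      Real.log c.M₁ - (Real.log 2 + c.errorProb W * Real.log c.M₁) -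
          (Real.log 2 + c.errorProb W * Real.log c.M₀) - mutualInfo (c.law W) c.W1 c.out2b ≤
        n * t.2.2.2.1 ∧
      Real.log c.M₂ - (Real.log 2 + c.errorProb W * Real.log c.M₂) -
          (Real.log 2 + c.errorProb W * Real.log c.M₀) - mutualInfo (c.law W) c.W2 c.out1b ≤
        n * t.2.2.2.2 := by
  let g : Y1a × Y1b × Y2a × Y2b → Y1b × Y2b := fun y => (y.2.1, y.2.2.2)
  let p := joint (PMF.uniformOfFintype (Fin c.M₀ × Fin c.M₁ × Fin c.M₂)) c.enc
  obtain ⟨μ, hμ⟩ : ∃ μ, μ = joint p fun a => memoryless W n a.2 := ⟨_, rfl⟩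
  have hlaw : c.law W = μ := hμ.symm
  choose q hq hU using fun i : Fin n => exists_condLaw μ
    (fun ω => (ω.1.1.1, past (fun i => g (ω.2 i)) i.1)) (fun ω => ω.1.2 i)
  obtain ⟨t, ht, hb, hd, ha, hc⟩ := exists_mem_infoRegion_of_sum W hn
    (fun i => prob_mem_stdSimplex μ (fun ω => (ω.1.1.1, past (fun i => g (ω.2 i)) i.1))) hq
    (fun i => prob_eq_sum_smul (hU i))
  have c0b : mutualInfo μ c.W0 c.out1b ≤ _ :=
    (mutualInfo_le_sum_outputEntropy p W (fun m => m.1) g Prod.fst hμ hq hU).trans hb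
  have c0d : mutualInfo μ c.W0 c.out2b ≤ _ :=
    (mutualInfo_le_sum_outputEntropy p W (fun m => m.1) g Prod.snd hμ hq hU).trans hd
  have c1 : condEntropy μ c.W1 c.out2b ≤
      condEntropy μ c.W0 c.out2b + condEntropy μ c.W1 c.out1a + n * t.2.2.2.1 := by
    rw [ha]
    exact condEntropy_le_sum p W (fun m => m.1) (fun m => m.2.1) (fun y => y.1) g Prod.snd h1 hμ
      hq hU
  have c2 : condEntropy μ c.W2 c.out1b ≤
      condEntropy μ c.W0 c.out1b + condEntropy μ c.W2 c.out2a + n * t.2.2.2.2 := by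
    rw [hc]
    exact condEntropy_le_sum p W (fun m => m.1) (fun m => m.2.2) (fun y => y.2.2.1) g Prod.fst h2
      hμ hq hU
  have f0b := condEntropy_le_errorProb W c c.W0 c.out1b c.dec1b fun ω h => Or.inl h
  have f0d := condEntropy_le_errorProb W c c.W0 c.out2b c.dec2b fun ω h => Or.inr (Or.inl h)
  have f1 := condEntropy_le_errorProb W c c.W1 c.out1a c.dec1a
    fun ω h => Or.inr (Or.inr (Or.inl h))
  have f2 := condEntropy_le_errorProb W c c.W2 c.out2a c.dec2a
    fun ω h => Or.inr (Or.inr (Or.inr h))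
  have e0 := entropy_W0 W c
  have e1 := entropy_W1 W c
  have e2 := entropy_W2 W c
  rw [hlaw] at f0b f0d f1 f2 e0 e1 e2 ⊢
  rw [mutualInfo_eq_entropy_sub_condEntropy, e0] at c0b c0d
  rw [mutualInfo_eq_entropy_sub_condEntropy, mutualInfo_eq_entropy_sub_condEntropy, e1, e2]
  exact ⟨t, ht, by linarith, by linarith, by linarith, by linarith⟩

end Codes

/-! ### Passage to the limit -/

section Asymptotics

variable {X Y1a Y1b Y2a Y2b : Type*}
  [Fintype X] [Fintype Y1a] [Fintype Y1b] [Fintype Y2a] [Fintype Y2b]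
  (W : X → PMF (Y1a × Y1b × Y2a × Y2b))

/-- An achievable triple satisfies the single-letter bounds up to every positive error. -/
lemma IsAchievable.exists_mem_infoRegion {R : ℝ × ℝ × ℝ} (hR : IsAchievable W R)
    (h1 : ∀ p : PMF X, IsMarkovChain (joint p W)
      (fun ω => ω.1) (fun ω => ω.2.1) (fun ω => (ω.2.2.1, ω.2.2.2.2)))
    (h2 : ∀ p : PMF X, IsMarkovChain (joint p W)
      (fun ω => ω.1) (fun ω => ω.2.2.2.1) (fun ω => (ω.2.2.1, ω.2.2.2.2)))
    {ε : ℝ} (hε : 0 < ε) :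
    ∃ t ∈ infoRegion W,
      R.1 - ε ≤ outputEntropy W (fun y => y.2.1) t.1 - t.2.1 ∧
      R.1 - ε ≤ outputEntropy W (fun y => y.2.2.2) t.1 - t.2.2.1 ∧
      R.2.1 - ε ≤ t.2.2.2.1 ∧ R.2.2 - ε ≤ t.2.2.2.2 := by
  obtain ⟨hR0, hR1, hR2, c, hrate, herr, hl1, hl2⟩ := hR
  obtain ⟨C, hC⟩ : ∃ C, ∀ t ∈ infoRegion W,
      ‖outputEntropy W (fun y => y.2.1) t.1 - t.2.1‖ ≤ C := by
    refine (isCompact_infoRegion W).exists_bound_of_continuousOn (Continuous.continuousOn ?_)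
    have := continuous_outputEntropy W fun y => y.2.1
    fun_prop
  -- `K` bounds the rate of the common message as soon as the error probability is at most `1/2`.
  set K : ℝ := 2 * (C + Real.log 2) with hK
  have hlog : Filter.Tendsto (fun n : ℕ => Real.log 2 / n) Filter.atTop (nhds 0) :=
    tendsto_const_div_atTop_nhds_zero_nat _
  have herrR : Filter.Tendsto (fun n => (c n).errorProb W * (K + R.1 + R.2.1 + R.2.2))
      Filter.atTop (nhds 0) := by simpa using herr.mul_const (K + R.1 + R.2.1 + R.2.2)
  have hε8 : 0 < ε / 8 := by positivity
  obtain ⟨n, ⟨hr0, hr1, hr2⟩, he, heR, hn1, hn2, hnlog, hn⟩ :=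
    ((hrate (ε / 8) hε8).and ((herr.eventually_le_const (show (0 : ℝ) < 1 / 2 by norm_num)).and
      ((herrR.eventually_le_const hε8).and ((hl1.eventually_le_const hε8).and
      ((hl2.eventually_le_const hε8).and ((hlog.eventually_le_const hε8).and
      (Filter.eventually_gt_atTop 0))))))).exists
  have hn' : (0 : ℝ) < n := by exact_mod_cast hn
  obtain ⟨t, ht, hb, hd, ha, hc⟩ := BroadcastChannel.exists_mem_infoRegion W (c n) hn h1 h2
  have hP : 0 ≤ (c n).errorProb W := ENNReal.toReal_nonneg
  rw [Code.leakage1] at hn1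
  rw [Code.leakage2] at hn2
  set P := (c n).errorProb W
  set m0 := Real.log (c n).M₀
  set m1 := Real.log (c n).M₁
  set m2 := Real.log (c n).M₂
  set L := Real.log 2 with hL
  have hdiv : ∀ {a b : ℝ}, a ≤ n * b → a / n ≤ b := fun h => (div_le_iff₀' hn').2 h
  have hb' := hdiv hb
  have hd' := hdiv hd
  have ha' := hdiv ha
  have hc' := hdiv hc
  simp only [sub_div, add_div, mul_div_assoc] at hb' hd' ha' hc'
  have hr0nonneg : 0 ≤ m0 / n := div_nonneg (Real.log_natCast_nonneg _) hn'.le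
  have hLn : L / n ≤ L := div_le_self (Real.log_nonneg one_le_two) (by exact_mod_cast hn)
  have hCt := (le_abs_self _).trans (hC t ht)
  have hr0K : m0 / n ≤ K := by nlinarith
  have hPK : P * (m0 / n) ≤ P * K := mul_le_mul_of_nonneg_left hr0K hP
  have hK0 : 0 ≤ K := hr0nonneg.trans hr0K
  have hPR0 : 0 ≤ P * R.1 := mul_nonneg hP hR0
  have hPR1 : 0 ≤ P * R.2.1 := mul_nonneg hP hR1
  have hPR2 : 0 ≤ P * R.2.2 := mul_nonneg hP hR2
  have hPK0 : 0 ≤ P * K := mul_nonneg hP hK0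
  have key : ∀ {r ρ : ℝ}, ρ - ε / 8 ≤ r → ρ - ε / 8 - P * ρ ≤ r - P * r := by
    intro r ρ h
    nlinarith [mul_le_mul_of_nonneg_left h (show 0 ≤ 1 - P by linarith), mul_nonneg hP hε8.le]
  have k0 := key hr0
  have k1 := key hr1
  have k2 := key hr2
  refine ⟨t, ht, ?_, ?_, ?_, ?_⟩ <;> linarith

end Asymptotics

end BroadcastChannel

theorem theorem3 {X Y1a Y1b Y2a Y2b : Type*}
    [Fintype X] [Fintype Y1a] [Fintype Y1b] [Fintype Y2a] [Fintype Y2b]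
    (W : X → PMF (Y1a × Y1b × Y2a × Y2b))
    (h1 : ∀ p : PMF X, BroadcastChannel.IsMarkovChain (BroadcastChannel.joint p W)
      (fun ω => ω.1) (fun ω => ω.2.1) (fun ω => (ω.2.2.1, ω.2.2.2.2)))
    (h2 : ∀ p : PMF X, BroadcastChannel.IsMarkovChain (BroadcastChannel.joint p W)
      (fun ω => ω.1) (fun ω => ω.2.2.2.1) (fun ω => (ω.2.2.1, ω.2.2.2.2))) :
    BroadcastChannel.secrecyCapacityRegion W ⊆ BroadcastChannel.outerRegion W := by
  intro R hR
  rw [BroadcastChannel.secrecyCapacityRegion, Metric.mem_closure_iff] at hR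
  have hclose : ∀ ε > 0, ∃ R' : ℝ × ℝ × ℝ, BroadcastChannel.IsAchievable W R' ∧
      R.1 - ε ≤ R'.1 ∧ R'.1 ≤ R.1 + ε ∧ R.2.1 - ε ≤ R'.2.1 ∧ R'.2.1 ≤ R.2.1 + ε ∧
      R.2.2 - ε ≤ R'.2.2 ∧ R'.2.2 ≤ R.2.2 + ε := by
    intro ε hε
    obtain ⟨R', hR', hd⟩ := hR ε hε
    simp only [Prod.dist_eq, max_lt_iff, Real.dist_eq, abs_lt] at hd
    exact ⟨R', hR', by linarith, by linarith, by linarith, by linarith, by linarith, by linarith⟩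
  refine BroadcastChannel.mem_outerRegion_of_forall_pos W ?_ ?_ ?_ ?_
  · refine le_of_forall_pos_le_add fun ε hε => ?_
    obtain ⟨R', hR', h⟩ := hclose ε hε
    exact hR'.1.trans h.2.1
  · refine le_of_forall_pos_le_add fun ε hε => ?_
    obtain ⟨R', hR', h⟩ := hclose ε hε
    exact hR'.2.1.trans h.2.2.2.1
  · refine le_of_forall_pos_le_add fun ε hε => ?_
    obtain ⟨R', hR', h⟩ := hclose ε hε
    exact hR'.2.2.1.trans h.2.2.2.2.2
  · intro ε hε
    obtain ⟨R', hR', h⟩ := hclose (ε / 2) (half_pos hε)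
    obtain ⟨t, ht, hb, hd, ha, hc⟩ := hR'.exists_mem_infoRegion W h1 h2 (half_pos hε)
    exact ⟨t, ht, by linarith, by linarith, by linarith, by linarith⟩
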